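/- Let $X$ be a (real or complex) Banach space whose dual $X^*$ is separable. Then $X^*$ has the bounded approximation property if and only if $X$ embeds complementably in a Banach space with a shrinking basis, i.e. if and only if there is a Banach space $Z$ with a shrinking Schauder basis such that $X$ is isomorphic (linearly homeomorphic) to a complemented subspace of $Z$. Here a Banach space $E$ has the bounded approximation property if there is a constant $\lambda$ such that for every compact set $K\subseteq E$ and every $\varepsilon>0$ there is a finite rank bounded linear operator $T$ on $E$ with $\|T\|\le\lambda$ and $\|x-Tx\|\le\varepsilon$ for all $x\in K$. A Schauder basis $(z_i)_{i=1}^\infty$ of $Z$ is shrinking if its biorthogonal functionals $(z_i^*)_{i=1}^\infty$ form a Schauder basis of $Z^*$. A subspace of $Z$ is complemented if it is the range of a bounded linear projection on $Z$. -/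

import Mathlib

universe u v w

/-- A normed space `E` over `𝕜` has the `l`-approximation property: for every compact set `K` and
every `ε > 0` there is a bounded finite rank operator `T` on `E` with `‖T‖ ≤ l` that is within `ε`
of the identity on `K`. -/
def HasLambdaAP (𝕜 : Type u) (E : Type v) [RCLike 𝕜] [NormedAddCommGroup E] [NormedSpace 𝕜 E]
    (l : ℝ) : Prop :=
  ∀ K : Set E, IsCompact K → ∀ ε : ℝ, 0 < ε →
    ∃ T : E →L[𝕜] E, FiniteDimensional 𝕜 (LinearMap.range (T : E →ₗ[𝕜] E)) ∧ ‖T‖ ≤ l ∧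
      ∀ x ∈ K, ‖x - T x‖ ≤ ε

/-- The bounded approximation property: the `l`-approximation property for some constant `l`. -/
def HasBAP (𝕜 : Type u) (E : Type v) [RCLike 𝕜] [NormedAddCommGroup E] [NormedSpace 𝕜 E] : Prop :=
  ∃ l : ℝ, HasLambdaAP 𝕜 E l

/-- A Schauder basis is shrinking if its sequence of biorthogonal functionals is (the sequence of
basis vectors of) a Schauder basis of the dual space, for the dual norm. -/
def SchauderBasis.IsShrinking {𝕜 : Type u} {E : Type v} [RCLike 𝕜] [NormedAddCommGroup E]
    [NormedSpace 𝕜 E] (b : SchauderBasis 𝕜 E) : Prop :=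
  ∃ d : SchauderBasis 𝕜 (StrongDual 𝕜 E), d.basis = b.coord

/-- `E` embeds complementably in `F`: `E` is linearly homeomorphic to a complemented subspace of
`F`, i.e. to a subspace which is the range of a bounded linear projection of `F`. -/
def EmbedsComplementably (𝕜 : Type u) (E : Type v) (F : Type w) [RCLike 𝕜]
    [NormedAddCommGroup E] [NormedSpace 𝕜 E] [NormedAddCommGroup F] [NormedSpace 𝕜 F] : Prop :=
  ∃ Y : Submodule 𝕜 F, Y.ClosedComplemented ∧ Nonempty (E ≃L[𝕜] Y)

/-! If `Z` has a shrinking basis, then `Z*` has a basis and `X*` is complemented in `Z*`; the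
partial sum projections compressed to `X*` give bounded approximation.

Conversely, finite rank operators on `X*` are first replaced by adjoints. By Hahn–Banach this
amounts to bounding `∑ φ j (A (g j))`, for `A` of finite rank on `X*`, by a bound valid for
adjoints; the cost is a factor 2 (`norm_sum_apply_le_of_finiteRank`). Separability then gives finite
rank `T n` on `X` with `T n → 1` and `(T n)* → 1` strongly. Splitting each difference `T (n+1) - T
n` into many small rank one pieces, so that partial sums stay near a segment, yields a frame `(x_k,
f_k)` whose partial sums `S_n` and their adjoints converge strongly to the identity
(`nonempty_shrinkingFrame_of_approximating_seq`).

The space with a basis is the completion of the finite sequences under `sup ‖R (∑_{k ≥ r} a_k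
x_k)‖`, over the pairs `(R, r)` with `‖R‖ ‖R (S_t - S_s)‖ ≤ 1` for `r ≤ s ≤ t`. Passing to tails is
contractive, so the unit vectors form a basis. A multiple of the identity is admitted, so `a ↦ ∑ a_k
x_k` is bounded; its right inverse `x ↦ (f_k x)` is bounded by `‖R w‖² ≤ (‖R‖ ‖R w‖) ‖w‖` with `w =
x - S_r x`.

The basis is shrinking for two reasons. Given `h` in `X*`, the operator `h ⊗ y` with `y` large is
admitted for large `r`, because `h ∘ S_n → h`; so `h` of the tail sums tends to 0 uniformly on the
ball. And each `z` is almost supported on the pairs with `r, ‖R‖ ≤ n`, so a functional almost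
attaining its norm at `z` is small off these pairs, while on them it sees only finitely many tail
sums. -/

section NormingSets

/-! ### Finite norming sets and duals of finite sums -/

variable {𝕜 : Type*} [RCLike 𝕜] {X E : Type*} [NormedAddCommGroup X] [NormedSpace 𝕜 X]
  [NormedAddCommGroup E] [NormedSpace 𝕜 E]

/-- A closed subspace `M` of finite codimension admits a finite subset of the unit ball which
norms, up to a factor `2`, every operator vanishing on `M`. -/
theorem Submodule.exists_finset_norm_le_two_mul (M : Submodule 𝕜 X) [FiniteDimensional 𝕜 (X ⧸ M)]
    (hM : IsClosed (M : Set X)) :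
    ∃ s : Finset X, (∀ y ∈ s, ‖y‖ ≤ 1) ∧ ∀ T : X →L[𝕜] E, (∀ x ∈ M, T x = 0) →
      ∀ b : ℝ, 0 ≤ b → (∀ y ∈ s, ‖T y‖ ≤ b) → ‖T‖ ≤ 2 * b := by
  classical
  have : IsClosed (M.toAddSubgroup : Set X) := hM
  have : ProperSpace (X ⧸ M) := FiniteDimensional.proper_rclike 𝕜 _
  have htb : TotallyBounded (Metric.closedBall (0 : X ⧸ M) 1) :=
    (isCompact_closedBall _ _).totallyBounded
  have hsub : M.mkQL '' Metric.closedBall (0 : X) 1 ⊆ Metric.closedBall (0 : X ⧸ M) 1 := by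
    rintro _ ⟨x, hx, rfl⟩
    rw [mem_closedBall_zero_iff] at hx ⊢
    exact (Submodule.Quotient.norm_mk_le M x).trans hx
  obtain ⟨t, hts, htf, ht⟩ :=
    Metric.finite_approx_of_totallyBounded (htb.subset hsub) (1 / 2) (by norm_num)
  obtain ⟨s, hs1, hsf, hs2⟩ := (Set.exists_subset_image_finite_and
    (p := fun t => M.mkQL '' Metric.closedBall (0 : X) 1 ⊆ ⋃ y ∈ t, Metric.ball y (1 / 2))).1
      ⟨t, hts, htf, ht⟩
  refine ⟨hsf.toFinset, fun y hy => by simpa using hs1 (by simpa using hy), ?_⟩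
  intro T hT b hb hTb
  -- The set lifts a `1/2`-net of the image of the ball in the quotient, so modulo `M` a unit vector
  -- is `y + m` with `‖m‖ < 1/2`.
  have key : ‖T‖ ≤ b + ‖T‖ / 2 := by
    refine T.opNorm_le_of_unit_norm (by positivity) fun x hx => ?_
    have hx' := hs2 ⟨x, by simp [hx], rfl⟩
    simp only [Set.mem_image, Set.iUnion_exists, Set.biUnion_and', Set.iUnion_iUnion_eq_right,
      Set.mem_iUnion, exists_prop] at hx'
    obtain ⟨y, hys, hy⟩ := hx'
    rw [Metric.mem_ball, dist_eq_norm] at hy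
    obtain ⟨m, hm, hm'⟩ := Submodule.Quotient.norm_mk_lt (S := M) (M.mkQL x - M.mkQL y)
      (sub_pos.2 hy)
    have hTm : T x = T y + T m := by
      have : m - (x - y) ∈ M := by
        rw [← Submodule.Quotient.eq, hm]; rfl
      have h0 := hT _ this
      simp only [map_sub, sub_eq_zero] at h0
      rw [h0]; abel
    rw [hTm]
    refine (norm_add_le _ _).trans (add_le_add (hTb y (by simpa using hys)) ?_)
    refine (T.le_opNorm m).trans ?_
    have : ‖m‖ ≤ 1 / 2 := by linarith
    calc ‖T‖ * ‖m‖ ≤ ‖T‖ * (1 / 2) := by gcongr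
      _ = ‖T‖ / 2 := by ring
  linarith

theorem ContinuousLinearMap.exists_norm_le_one_lt_re (h : StrongDual 𝕜 X) {ε : ℝ} (hε : 0 < ε) :
    ∃ x : X, ‖x‖ ≤ 1 ∧ ‖h‖ - ε < RCLike.re (h x) := by
  rcases le_or_gt ‖h‖ 0 with h0 | h0
  · exact ⟨0, by simp, by simpa using h0.trans_lt hε⟩
  obtain ⟨x, hx, hx'⟩ := h.exists_lt_apply_of_lt_opNorm (sub_lt_self ‖h‖ hε)
  obtain ⟨c, hc, hc'⟩ := RCLike.exists_norm_eq_mul_self (h x)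
  refine ⟨c • x, ?_, ?_⟩
  · rw [norm_smul, hc, one_mul]; exact hx.le
  · rw [map_smul, smul_eq_mul]
    rw [← hc', RCLike.ofReal_re]
    exact hx'

/-- Vectors almost norming the components of `H` combine into a single vector of the unit ball of
the `ℓ^∞`-sum, where the values add up. -/
theorem ContinuousLinearMap.sum_norm_comp_single_le {ι : Type*} [Fintype ι] [DecidableEq ι]
    (H : StrongDual 𝕜 (ι → X)) :
    ∑ i, ‖H ∘L ContinuousLinearMap.single 𝕜 (fun _ : ι => X) i‖ ≤ ‖H‖ := by
  refine le_of_forall_pos_le_add fun ε hε => ?_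
  have hδ : 0 < ε / (Fintype.card ι + 1) := by positivity
  choose x hx hx' using fun i => ContinuousLinearMap.exists_norm_le_one_lt_re
    (H ∘L ContinuousLinearMap.single 𝕜 (fun _ : ι => X) i) hδ
  have hsum : H x = ∑ i, H (Pi.single i (x i)) := by
    rw [← map_sum, Finset.univ_sum_single]
  have hHx : RCLike.re (H x) ≤ ‖H‖ := by
    refine (RCLike.re_le_norm _).trans ((H.le_opNorm x).trans ?_)
    exact mul_le_of_le_one_right (norm_nonneg _) ((pi_norm_le_iff_of_nonneg zero_le_one).2 hx)
  have h1 : ∑ i, (‖H ∘L ContinuousLinearMap.single 𝕜 (fun _ : ι => X) i‖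
      - ε / (Fintype.card ι + 1)) ≤ RCLike.re (H x) := by
    rw [hsum, map_sum]
    exact Finset.sum_le_sum fun i _ => (hx' i).le
  rw [Finset.sum_sub_distrib, Finset.sum_const, nsmul_eq_mul, Finset.card_univ] at h1
  have h2 : (Fintype.card ι : ℝ) * (ε / (Fintype.card ι + 1)) ≤ ε := by
    rw [mul_div_assoc', div_le_iff₀ (by positivity)]
    nlinarith
  linarith

end NormingSets

/-! ### Local reflexivity by trace duality -/

section LocalReflexivity

variable {𝕜 : Type*} [RCLike 𝕜] {X : Type*} [NormedAddCommGroup X] [NormedSpace 𝕜 X]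

/-- A functional dominated by the norm of a linear map `J` into a normed space factors through `J`
with the same bound. -/
theorem exists_functional_extension {V W : Type*} [AddCommGroup V] [Module 𝕜 V]
    [NormedAddCommGroup W] [NormedSpace 𝕜 W] (J : V →ₗ[𝕜] W) (G : V →ₗ[𝕜] 𝕜) {C : ℝ}
    (hC : 0 ≤ C) (h : ∀ v, ‖G v‖ ≤ C * ‖J v‖) :
    ∃ H : StrongDual 𝕜 W, (∀ v, H (J v) = G v) ∧ ‖H‖ ≤ C := by
  -- The section is only linear; by `h`, `G` vanishes on the kernel of `J`, so the choice does not
  -- matter.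
  obtain ⟨σ, hσ⟩ := J.rangeRestrict.exists_rightInverse_of_surjective J.range_rangeRestrict
  have hσ' : ∀ w, J (σ w) = w := fun w => congrArg Subtype.val (LinearMap.congr_fun hσ w)
  let K : StrongDual 𝕜 (LinearMap.range J) := (G ∘ₗ σ).mkContinuous C fun w => by
    simpa [hσ' w] using h (σ w)
  obtain ⟨H, hH, hHK⟩ := exists_extension_norm_eq _ K
  refine ⟨H, fun v => ?_, hHK.trans_le (LinearMap.mkContinuous_norm_le _ hC _)⟩
  rw [hH ⟨J v, v, rfl⟩]
  have := h (σ ⟨J v, v, rfl⟩ - v)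
  rw [map_sub J, hσ', sub_self, norm_zero, mul_zero, norm_le_zero_iff, map_sub, sub_eq_zero] at this
  exact this

/-- A weak form of local reflexivity. -/
theorem norm_sum_apply_le_of_finiteRank {J : Type*} [Fintype J]
    (φ : J → StrongDual 𝕜 (StrongDual 𝕜 X)) (g : J → StrongDual 𝕜 X) {C : ℝ} (hC : 0 ≤ C)
    (h : ∀ T : X →L[𝕜] X, FiniteDimensional 𝕜 (LinearMap.range (T : X →ₗ[𝕜] X)) →
      ‖∑ j, φ j (g j ∘L T)‖ ≤ C * ‖T‖)
    (A : StrongDual 𝕜 X →L[𝕜] StrongDual 𝕜 X)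
    (hA : FiniteDimensional 𝕜 (LinearMap.range (A : StrongDual 𝕜 X →ₗ[𝕜] StrongDual 𝕜 X))) :
    ‖∑ j, φ j (A (g j))‖ ≤ 2 * C * ‖A‖ := by
  classical
  set F := LinearMap.range (A : StrongDual 𝕜 X →ₗ[𝕜] StrongDual 𝕜 X) with hF
  have : Module.Free 𝕜 F := Module.Free.of_divisionRing 𝕜 F
  let b := Module.finBasis 𝕜 F
  let f : Fin (Module.finrank 𝕜 F) → StrongDual 𝕜 X := fun i => b i
  let L : X →L[𝕜] (Fin (Module.finrank 𝕜 F) → 𝕜) := ContinuousLinearMap.pi f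
  let M : Submodule 𝕜 X := LinearMap.ker (L : X →ₗ[𝕜] (Fin (Module.finrank 𝕜 F) → 𝕜))
  have hM : IsClosed (M : Set X) := L.isClosed_ker
  have hfd : FiniteDimensional 𝕜 (X ⧸ M) :=
    (LinearMap.quotKerEquivRange
      (L : X →ₗ[𝕜] (Fin (Module.finrank 𝕜 F) → 𝕜))).symm.finiteDimensional
  have hMF : ∀ v ∈ F, ∀ x ∈ M, v x = 0 := by
    intro v hv x hx
    have hx' : ∀ i, f i x = 0 := fun i => congrFun (LinearMap.mem_ker.1 hx) i
    have := congrArg (fun w : F => (w : StrongDual 𝕜 X) x) (b.sum_repr ⟨v, hv⟩)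
    simp only [Submodule.coe_sum, Submodule.coe_smul, sum_apply,
      smul_apply] at this
    rw [← this]
    exact Finset.sum_eq_zero fun i _ => by
      rw [show ((b i : F) : StrongDual 𝕜 X) x = 0 from hx' i, smul_zero]
  obtain ⟨s, hs1, hs⟩ := M.exists_finset_norm_le_two_mul (E := X) hM
  -- On `V`, which contains every `v ⊗ x` with `v ∈ F`, the norm is controlled by the values at the
  -- finite set `s`.
  let V : Submodule 𝕜 (X →L[𝕜] X) :=
    { carrier := {T | ∀ x ∈ M, T x = 0}
      add_mem' := fun {S T} hS hT x hx => by simp [hS x hx, hT x hx]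
      zero_mem' := fun x _ => rfl
      smul_mem' := fun c T hT x hx => by simp [hT x hx] }
  have hVfin : ∀ T ∈ V, FiniteDimensional 𝕜 (LinearMap.range (T : X →ₗ[𝕜] X)) := by
    intro T hT
    have hle : M ≤ LinearMap.ker (T : X →ₗ[𝕜] X) := fun x hx => hT x hx
    rw [← Submodule.range_liftQ M (T : X →ₗ[𝕜] X) hle]
    infer_instance
  let G : V →ₗ[𝕜] 𝕜 :=
    { toFun := fun T => ∑ j, φ j (g j ∘L (T : X →L[𝕜] X))
      map_add' := fun S T => by simp [Finset.sum_add_distrib]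
      map_smul' := fun c T => by simp [Finset.mul_sum] }
  let Jm : V →ₗ[𝕜] (s → X) :=
    { toFun := fun T y => (T : X →L[𝕜] X) y
      map_add' := fun S T => by ext; simp
      map_smul' := fun c T => by ext; simp }
  obtain ⟨H, hH, hHC⟩ := exists_functional_extension Jm G (C := 2 * C) (by positivity) (by
    intro T
    have h1 := hs T T.2 ‖Jm T‖ (norm_nonneg _) fun y hy => norm_le_pi_norm (Jm T) ⟨y, hy⟩
    calc ‖G T‖ ≤ C * ‖(T : X →L[𝕜] X)‖ := h T (hVfin T T.2)
      _ ≤ C * (2 * ‖Jm T‖) := by gcongr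
      _ = _ := by ring)
  let hk : s → StrongDual 𝕜 X := fun k => H ∘L ContinuousLinearMap.single 𝕜 (fun _ : s => X) k
  have hHsum : ∀ w, H w = ∑ k, hk k (w k) := by
    intro w
    conv_lhs => rw [← Finset.univ_sum_single w, map_sum]
    rfl
  -- Evaluating `H` at `v ⊗ x` shows that the tensors `∑ φ j ⊗ g j` and `∑ k ⊗ hk k` agree on `F`.
  -- As `A` has range `F`, both have the same pairing with `A`.
  have hstar : ∀ v ∈ F, ∑ j, φ j v • g j = ∑ k : s, v k • hk k := by
    intro v hv
    ext x
    have h1 := hH ⟨v.smulRight x, fun y hy => by simp [hMF v hv y hy]⟩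
    rw [hHsum] at h1
    have h2 : ∀ j, g j ∘L v.smulRight x = g j x • v := by
      intro j; ext y; simp [mul_comm]
    simp only [Jm, G, LinearMap.coe_mk, AddHom.coe_mk, h2, map_smul,
      ContinuousLinearMap.smulRight_apply, smul_eq_mul] at h1
    simp only [sum_apply, smul_apply, smul_eq_mul]
    rw [h1]
    exact Finset.sum_congr rfl fun j _ => mul_comm _ _
  let ξ : Fin (Module.finrank 𝕜 F) → StrongDual 𝕜 X →ₗ[𝕜] 𝕜 := fun i =>
    b.coord i ∘ₗ (A : StrongDual 𝕜 X →ₗ[𝕜] StrongDual 𝕜 X).rangeRestrict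
  have hAξ : ∀ u, A u = ∑ i, ξ i u • f i := by
    intro u
    have := congrArg (fun w : F => (w : StrongDual 𝕜 X))
      (b.sum_repr ((A : StrongDual 𝕜 X →ₗ[𝕜] StrongDual 𝕜 X).rangeRestrict u))
    simp only [Submodule.coe_sum, Submodule.coe_smul] at this
    exact this.symm
  have hmain : ∑ j, φ j (A (g j)) = ∑ k : s, A (hk k) k := by
    calc ∑ j, φ j (A (g j)) = ∑ i, ξ i (∑ j, φ j (f i) • g j) := by
          simp only [hAξ, map_sum, map_smul, smul_eq_mul]
          rw [Finset.sum_comm]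
          exact Finset.sum_congr rfl fun i _ => Finset.sum_congr rfl fun j _ => mul_comm _ _
      _ = ∑ i, ξ i (∑ k : s, f i k • hk k) := by
          exact Finset.sum_congr rfl fun i _ => by rw [hstar (f i) (b i).2]
      _ = ∑ k : s, A (hk k) k := by
          simp only [hAξ, map_sum, map_smul, smul_eq_mul, sum_apply,
            smul_apply]
          rw [Finset.sum_comm]
          exact Finset.sum_congr rfl fun i _ => Finset.sum_congr rfl fun j _ => mul_comm _ _
  rw [hmain]
  calc ‖∑ k : s, A (hk k) k‖ ≤ ∑ k : s, ‖A‖ * ‖hk k‖ := by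
        refine norm_sum_le_of_le _ fun k _ => ?_
        calc ‖A (hk k) k‖ ≤ ‖A (hk k)‖ * ‖(k : X)‖ := ContinuousLinearMap.le_opNorm _ _
          _ ≤ ‖A (hk k)‖ * 1 := by gcongr; exact hs1 k k.2
          _ ≤ ‖A‖ * ‖hk k‖ := by rw [mul_one]; exact A.le_opNorm _
    _ = ‖A‖ * ∑ k : s, ‖hk k‖ := by rw [Finset.mul_sum]
    _ ≤ ‖A‖ * (2 * C) := by
        gcongr
        exact H.sum_norm_comp_single_le.trans hHC
    _ = 2 * C * ‖A‖ := by ring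

end LocalReflexivity

/-! ### Separation and density arguments -/

section Separation

variable {𝕜 : Type*} [RCLike 𝕜] {E : Type*} [NormedAddCommGroup E] [NormedSpace 𝕜 E]

/-- Hahn–Banach separation of a point from the closure of an absolutely convex set. -/
theorem exists_dual_norm_le_lt_re {S : Set E} (h0 : (0 : E) ∈ S)
    (hconv : ∀ x ∈ S, ∀ y ∈ S, ∀ a b : ℝ, 0 ≤ a → 0 ≤ b → a + b = 1 →
      (a : 𝕜) • x + (b : 𝕜) • y ∈ S)
    (hbal : ∀ x ∈ S, ∀ c : 𝕜, ‖c‖ ≤ 1 → c • x ∈ S) {w : E} (hw : w ∉ closure S) :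
    ∃ (f : StrongDual 𝕜 E) (u : ℝ), 0 ≤ u ∧ (∀ x ∈ S, ‖f x‖ ≤ u) ∧ u < RCLike.re (f w) := by
  let : NormedSpace ℝ E := NormedSpace.restrictScalars ℝ 𝕜 E
  have : IsScalarTower ℝ 𝕜 E := RestrictScalars.isScalarTower ℝ 𝕜 E
  have hS : Convex ℝ S := by
    intro x hx y hy a b ha hb hab
    have := hconv x hx y hy a b ha hb hab
    rwa [← RCLike.real_smul_eq_coe_smul, ← RCLike.real_smul_eq_coe_smul] at this
  obtain ⟨f, u, hf, hu⟩ := RCLike.geometric_hahn_banach_closed_point (𝕜 := 𝕜) hS.closure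
    isClosed_closure hw
  refine ⟨f, u, ?_, fun x hx => ?_, hu⟩
  · simpa using (hf 0 (subset_closure h0)).le
  · obtain ⟨c, hc, hc'⟩ := RCLike.exists_norm_eq_mul_self (f x)
    have := hf (c • x) (subset_closure (hbal x hx c hc.le))
    rw [map_smul, smul_eq_mul, ← hc', RCLike.ofReal_re] at this
    exact this.le

/-- Equi-Lipschitz maps converging pointwise to the identity on a set do so on its closure. -/
theorem tendsto_id_of_mem_closure {F : ℕ → E → E} {K : ℝ} {s : Set E} {x : E}
    (hK : ∀ n, ∀ y ∈ s, ‖F n x - F n y‖ ≤ K * ‖x - y‖)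
    (hs : ∀ y ∈ s, Filter.Tendsto (fun n => F n y) Filter.atTop (nhds y))
    (hx : x ∈ closure s) : Filter.Tendsto (fun n => F n x) Filter.atTop (nhds x) := by
  rw [Metric.tendsto_atTop]
  intro ε hε
  have hK' : 0 < |K| + 2 := by positivity
  obtain ⟨y, hy, hxy⟩ := Metric.mem_closure_iff.1 hx (ε / (|K| + 2)) (by positivity)
  obtain ⟨N, hN⟩ := Metric.tendsto_atTop.1 (hs y hy) (ε / (|K| + 2)) (by positivity)
  refine ⟨N, fun n hn => ?_⟩
  have h1 := hN n hn
  rw [dist_eq_norm] at h1 hxy ⊢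
  have h2 : ‖F n x - F n y‖ ≤ |K| * (ε / (|K| + 2)) :=
    (hK n y hy).trans (mul_le_mul (le_abs_self K) hxy.le (norm_nonneg _) (abs_nonneg _))
  have h3 : ‖F n x - x‖ ≤ ‖F n x - F n y‖ + ‖F n y - y‖ + ‖x - y‖ := by
    have : F n x - x = (F n x - F n y) + (F n y - y) - (x - y) := by abel
    rw [this]
    exact (norm_sub_le _ _).trans (add_le_add_left (norm_add_le _ _) _)
  have h4 : |K| * (ε / (|K| + 2)) + ε / (|K| + 2) + ε / (|K| + 2) = ε := by
    field_simp; ring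
  linarith

/-- Vectors almost norming a dense sequence of functionals span a dense subspace: a nonzero
functional vanishing on them would stay away from that sequence. -/
theorem separableSpace_of_separableSpace_dual [TopologicalSpace.SeparableSpace (StrongDual 𝕜 E)] :
    TopologicalSpace.SeparableSpace E := by
  have key : ∀ g : StrongDual 𝕜 E, ∃ x : E, ‖x‖ ≤ 1 ∧ ‖g‖ / 2 ≤ ‖g x‖ := by
    intro g
    rcases (norm_nonneg g).eq_or_lt with h | h
    · exact ⟨0, by simp, by simp [← h]⟩
    · obtain ⟨x, hx, hx'⟩ := g.exists_norm_le_one_lt_re (half_pos h)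
      exact ⟨x, hx, by linarith [RCLike.re_le_norm (g x)]⟩
  choose x hx hx' using fun n => key (TopologicalSpace.denseSeq (StrongDual 𝕜 E) n)
  have hsep : TopologicalSpace.IsSeparable (Submodule.span 𝕜 (Set.range x) : Set E) :=
    ((Set.countable_range x).isSeparable).span
  have htop : (Submodule.span 𝕜 (Set.range x)).topologicalClosure = ⊤ := by
    by_contra hne
    obtain ⟨v, hv⟩ : ∃ v, v ∉ (Submodule.span 𝕜 (Set.range x)).topologicalClosure := by
      by_contra! h
      exact hne (eq_top_iff.2 fun v _ => h v)
    obtain ⟨f, u, hu0, hfu, hfv⟩ := exists_dual_norm_le_lt_re (𝕜 := 𝕜)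
      (S := (Submodule.span 𝕜 (Set.range x) : Set E)) (Submodule.zero_mem _)
      (fun y hy z hz a b _ _ _ =>
        Submodule.add_mem _ (Submodule.smul_mem _ _ hy) (Submodule.smul_mem _ _ hz))
      (fun y hy c _ => Submodule.smul_mem _ c hy) hv
    have hfx : ∀ n, f (x n) = 0 := by
      intro n
      by_contra h
      have h1 := hfu _ (Submodule.smul_mem _ (((u + 1) / ‖f (x n)‖ : ℝ) : 𝕜)
        (Submodule.subset_span ⟨n, rfl⟩ : x n ∈ Submodule.span 𝕜 (Set.range x)))
      rw [map_smul, norm_smul, RCLike.norm_ofReal, abs_of_nonneg (by positivity),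
        div_mul_cancel₀ _ (norm_ne_zero_iff.2 h)] at h1
      linarith
    have hf : 0 < ‖f‖ := by
      rw [norm_pos_iff]
      rintro rfl
      simp only [zero_apply, map_zero] at hfv
      linarith
    obtain ⟨_, ⟨n, rfl⟩, hn⟩ := Metric.mem_closure_iff.1
      (TopologicalSpace.denseRange_denseSeq (StrongDual 𝕜 E) f) (‖f‖ / 3) (by positivity)
    rw [dist_comm, dist_eq_norm] at hn
    set g := TopologicalSpace.denseSeq (StrongDual 𝕜 E) n
    have h1 : ‖g (x n)‖ ≤ ‖g - f‖ := by
      have := (g - f).le_opNorm (x n)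
      rw [sub_apply, hfx, sub_zero] at this
      exact this.trans (mul_le_of_le_one_right (norm_nonneg _) (hx n))
    have h2 : ‖f‖ ≤ ‖g‖ + ‖g - f‖ := by
      simpa using norm_sub_le g (g - f)
    linarith [hx' n]
  have : TopologicalSpace.IsSeparable (Set.univ : Set E) := by
    have := hsep.closure
    rwa [← Submodule.topologicalClosure_coe, htop] at this
  exact TopologicalSpace.isSeparable_univ_iff.1 this

end Separation

/-! ### Finite rank operators -/

section FiniteRank

variable {𝕜 : Type*} [RCLike 𝕜] {X Y W : Type*} [NormedAddCommGroup X] [NormedSpace 𝕜 X]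
  [NormedAddCommGroup Y] [NormedSpace 𝕜 Y] [NormedAddCommGroup W] [NormedSpace 𝕜 W]

/-- A bounded operator with finite-dimensional range. -/
def ContinuousLinearMap.IsFiniteRank (T : X →L[𝕜] Y) : Prop :=
  FiniteDimensional 𝕜 (LinearMap.range (T : X →ₗ[𝕜] Y))

theorem ContinuousLinearMap.IsFiniteRank.of_range_le {T : X →L[𝕜] Y} {F : Submodule 𝕜 Y}
    [FiniteDimensional 𝕜 F] (h : ∀ x, T x ∈ F) : T.IsFiniteRank := by
  refine Submodule.finiteDimensional_of_le (S₂ := F) ?_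
  rintro _ ⟨x, rfl⟩
  exact h x

theorem ContinuousLinearMap.IsFiniteRank.zero : (0 : X →L[𝕜] Y).IsFiniteRank :=
  .of_range_le (F := ⊥) (by simp)

theorem ContinuousLinearMap.IsFiniteRank.add {S T : X →L[𝕜] Y} (hS : S.IsFiniteRank)
    (hT : T.IsFiniteRank) : (S + T).IsFiniteRank := by
  unfold IsFiniteRank at hS hT
  exact .of_range_le (F := LinearMap.range (S : X →ₗ[𝕜] Y) ⊔ LinearMap.range (T : X →ₗ[𝕜] Y))
    fun x => Submodule.add_mem_sup ⟨x, rfl⟩ ⟨x, rfl⟩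

theorem ContinuousLinearMap.IsFiniteRank.smul {T : X →L[𝕜] Y} (hT : T.IsFiniteRank) (c : 𝕜) :
    (c • T).IsFiniteRank := by
  unfold IsFiniteRank at hT
  exact .of_range_le (F := LinearMap.range (T : X →ₗ[𝕜] Y)) fun x => ⟨c • x, by simp⟩

theorem ContinuousLinearMap.IsFiniteRank.sub {S T : X →L[𝕜] Y} (hS : S.IsFiniteRank)
    (hT : T.IsFiniteRank) : (S - T).IsFiniteRank := by
  have := hS.add (hT.smul (-1))
  rwa [neg_one_smul, ← sub_eq_add_neg] at this

end FiniteRank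

/-! ### From approximation on the dual to approximation by adjoints -/

section ApproximatingSequence

variable {𝕜 : Type*} [RCLike 𝕜] {X : Type*} [NormedAddCommGroup X] [NormedSpace 𝕜 X]

theorem HasLambdaAP.nonneg {E : Type*} [NormedAddCommGroup E] [NormedSpace 𝕜 E] {l : ℝ}
    (h : HasLambdaAP 𝕜 E l) : 0 ≤ l := by
  obtain ⟨T, -, hT, -⟩ := h ∅ isCompact_empty 1 one_pos
  exact (norm_nonneg T).trans hT

/-- If the dual has the bounded approximation property, then it has it with adjoint operators,
which can moreover be taken to be pointwise approximations of the identity on the predual. -/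
theorem HasLambdaAP.exists_predual_approx {l : ℝ} (hl : HasLambdaAP 𝕜 (StrongDual 𝕜 X) l)
    {ι κ : Type*} [Fintype ι] [Fintype κ] (g : ι → StrongDual 𝕜 X) (x : κ → X) {ε : ℝ}
    (hε : 0 < ε) :
    ∃ T : X →L[𝕜] X, T.IsFiniteRank ∧ ‖T‖ ≤ 2 * l + 1 ∧ (∀ i, ‖g i ∘L T - g i‖ ≤ ε) ∧
      ∀ k, ‖T (x k) - x k‖ ≤ ε := by
  classical
  have hl0 := hl.nonneg
  let Θ : (X →L[𝕜] X) →ₗ[𝕜] (ι → StrongDual 𝕜 X) × (κ → X) :=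
    { toFun := fun T => (fun i => g i ∘L T, fun k => T (x k))
      map_add' := fun S T => by ext <;> simp
      map_smul' := fun c T => by ext <;> simp }
  let D : Set (X →L[𝕜] X) := {T | T.IsFiniteRank ∧ ‖T‖ ≤ 2 * l + 1}
  suffices hmem : (g, x) ∈ closure (Θ '' D) by
    obtain ⟨_, ⟨T, ⟨hT, hTl⟩, rfl⟩, hd⟩ := Metric.mem_closure_iff.1 hmem ε hε
    rw [dist_comm, dist_eq_norm] at hd
    refine ⟨T, hT, hTl, fun i => ?_, fun k => ?_⟩
    · exact ((norm_le_pi_norm (Θ T - (g, x)).1 i).trans (norm_fst_le _)).trans hd.le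
    · exact ((norm_le_pi_norm (Θ T - (g, x)).2 k).trans (norm_snd_le _)).trans hd.le
  by_contra hw
  obtain ⟨f, u, hu0, hfu, hu⟩ := exists_dual_norm_le_lt_re (𝕜 := 𝕜) (S := Θ '' D)
    ⟨0, ⟨.zero, by simpa using by positivity⟩, map_zero _⟩ (by
      rintro _ ⟨S, ⟨hS, hS'⟩, rfl⟩ _ ⟨T, ⟨hT, hT'⟩, rfl⟩ a b ha hb hab
      refine ⟨(a : 𝕜) • S + (b : 𝕜) • T, ⟨(hS.smul _).add (hT.smul _), ?_⟩, by simp⟩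
      refine (norm_add_le _ _).trans ?_
      rw [norm_smul, norm_smul, RCLike.norm_ofReal, RCLike.norm_ofReal, abs_of_nonneg ha,
        abs_of_nonneg hb]
      nlinarith) (by
      rintro _ ⟨S, ⟨hS, hS'⟩, rfl⟩ c hc
      refine ⟨c • S, ⟨hS.smul _, ?_⟩, by simp⟩
      rw [norm_smul]
      exact (mul_le_of_le_one_left (norm_nonneg _) hc).trans hS') hw
  -- These express `f (Θ T)` as `∑ j, φ j (G j ∘L T)`; for the coordinates in `X`, a functional of
  -- `T (x k)` is evaluation at `x k` of its composite with `T`.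
  let φ : ι ⊕ κ → StrongDual 𝕜 (StrongDual 𝕜 X) := Sum.elim
    (fun i => f ∘L ContinuousLinearMap.inl 𝕜 _ _ ∘L
      ContinuousLinearMap.single 𝕜 (fun _ : ι => StrongDual 𝕜 X) i)
    (fun k => NormedSpace.inclusionInDoubleDual 𝕜 X (x k))
  let G : ι ⊕ κ → StrongDual 𝕜 X := Sum.elim g
    (fun k => f ∘L ContinuousLinearMap.inr 𝕜 _ _ ∘L ContinuousLinearMap.single 𝕜 (fun _ : κ => X) k)
  have hdec : ∀ p : (ι → StrongDual 𝕜 X) × (κ → X), f p =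
      ∑ i, f (Pi.single i (p.1 i), 0) + ∑ k, f (0, Pi.single k (p.2 k)) := by
    intro p
    have h1 : p = (∑ i, Pi.single i (p.1 i), 0) + (0, ∑ k, Pi.single k (p.2 k)) := by
      rw [Finset.univ_sum_single, Finset.univ_sum_single]; ext <;> simp
    conv_lhs => rw [h1, map_add]
    congr 1
    · change (f ∘L ContinuousLinearMap.inl 𝕜 _ _) (∑ i, Pi.single i (p.1 i)) = _
      rw [map_sum]; rfl
    · change (f ∘L ContinuousLinearMap.inr 𝕜 _ _) (∑ k, Pi.single k (p.2 k)) = _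
      rw [map_sum]; rfl
  have hΘ : ∀ T : X →L[𝕜] X, ∑ j, φ j (G j ∘L T) = f (Θ T) := by
    intro T
    rw [hdec, Fintype.sum_sum_type]
    rfl
  have hone : ∑ j, φ j (G j) = f (g, x) := by
    rw [hdec, Fintype.sum_sum_type]
    rfl
  have hC : ∀ T : X →L[𝕜] X, FiniteDimensional 𝕜 (LinearMap.range (T : X →ₗ[𝕜] X)) →
      ‖∑ j, φ j (G j ∘L T)‖ ≤ u / (2 * l + 1) * ‖T‖ := by
    intro T hT
    rw [hΘ]
    rcases eq_or_ne T 0 with rfl | hT0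
    · simp
    have hTn : 0 < ‖T‖ := norm_pos_iff.2 hT0
    have h1 := hfu _ ⟨(((2 * l + 1) / ‖T‖ : ℝ) : 𝕜) • T,
      ⟨ContinuousLinearMap.IsFiniteRank.smul hT _, by
        rw [norm_smul, RCLike.norm_ofReal, abs_of_nonneg (by positivity),
          div_mul_cancel₀ _ hTn.ne']⟩, rfl⟩
    rw [map_smul, map_smul, norm_smul, RCLike.norm_ofReal, abs_of_nonneg (by positivity)] at h1
    rw [div_mul_eq_mul_div, le_div_iff₀ (by positivity)]
    rw [div_mul_eq_mul_div, div_le_iff₀ hTn] at h1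
    linarith
  set δ := RCLike.re (f (g, x)) - u with hδ
  have hδ0 : 0 < δ := sub_pos.2 hu
  set N := ∑ j, ‖φ j‖ with hN
  have hN0 : 0 ≤ N := Finset.sum_nonneg fun j _ => norm_nonneg (φ j)
  obtain ⟨A, hA, hAl, hAG⟩ := hl (Set.range G) (Set.finite_range G).isCompact (δ / (N + 1))
    (by positivity)
  have h1 := norm_sum_apply_le_of_finiteRank φ G (by positivity) hC A hA
  have h2 : ‖∑ j, φ j (G j - A (G j))‖ ≤ N * (δ / (N + 1)) := by
    rw [hN, Finset.sum_mul]
    exact norm_sum_le_of_le _ fun j _ => ((φ j).le_opNorm _).trans (by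
      gcongr; exact hAG _ ⟨j, rfl⟩)
  have h3 : N * (δ / (N + 1)) < δ := by
    rw [mul_div_assoc', div_lt_iff₀ (by positivity)]; nlinarith
  -- The bound `2 * l + 1` in `D` absorbs the factor 2 of local reflexivity; the `+ 1` keeps the
  -- denominator positive.
  have h4 : 2 * (u / (2 * l + 1)) * ‖A‖ ≤ u := by
    calc 2 * (u / (2 * l + 1)) * ‖A‖ ≤ 2 * (u / (2 * l + 1)) * l := by gcongr
      _ ≤ u := by
        rw [mul_div_assoc', div_mul_eq_mul_div, div_le_iff₀ (by positivity)]; nlinarith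
  have h5 : f (g, x) = ∑ j, φ j (A (G j)) + ∑ j, φ j (G j - A (G j)) := by
    rw [← hone, ← Finset.sum_add_distrib]
    exact Finset.sum_congr rfl fun j _ => by rw [map_sub]; ring
  have h6 := (RCLike.re_le_norm (f (g, x))).trans (h5 ▸ norm_add_le _ _)
  linarith

theorem HasBAP.exists_approximating_seq [TopologicalSpace.SeparableSpace (StrongDual 𝕜 X)]
    (h : HasBAP 𝕜 (StrongDual 𝕜 X)) :
    ∃ T : ℕ → X →L[𝕜] X, (∀ n, (T n).IsFiniteRank) ∧
      (∀ x, Filter.Tendsto (fun n => T n x) Filter.atTop (nhds x)) ∧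
      ∀ g : StrongDual 𝕜 X, Filter.Tendsto (fun n => g ∘L T n) Filter.atTop (nhds g) := by
  obtain ⟨l, hl⟩ := h
  have := separableSpace_of_separableSpace_dual (𝕜 := 𝕜) (E := X)
  choose T hT hTl hTg hTx using fun n : ℕ => hl.exists_predual_approx
    (fun i : Fin n => TopologicalSpace.denseSeq (StrongDual 𝕜 X) i)
    (fun i : Fin n => TopologicalSpace.denseSeq X i) (ε := 1 / ((n : ℝ) + 1)) (by positivity)
  refine ⟨T, hT, fun x => ?_, fun g => ?_⟩
  · refine tendsto_id_of_mem_closure (F := fun n x => T n x) (K := 2 * l + 1)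
      (s := Set.range (TopologicalSpace.denseSeq X)) (fun n y _ => ?_) ?_
      (TopologicalSpace.denseRange_denseSeq X x)
    · rw [← map_sub]
      exact ((T n).le_opNorm _).trans (by gcongr; exact hTl n)
    · rintro _ ⟨k, rfl⟩
      rw [tendsto_iff_norm_sub_tendsto_zero]
      refine squeeze_zero' (.of_forall fun _ => norm_nonneg _) ?_
        tendsto_one_div_add_atTop_nhds_zero_nat
      filter_upwards [Filter.eventually_gt_atTop k] with n hn
      exact hTx n ⟨k, hn⟩
  · refine tendsto_id_of_mem_closure (F := fun n (g : StrongDual 𝕜 X) => g ∘L T n)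
      (K := 2 * l + 1) (s := Set.range (TopologicalSpace.denseSeq (StrongDual 𝕜 X)))
      (fun n y _ => ?_) ?_ (TopologicalSpace.denseRange_denseSeq _ g)
    · rw [← ContinuousLinearMap.sub_comp, mul_comm]
      exact (ContinuousLinearMap.opNorm_comp_le _ _).trans (by gcongr; exact hTl n)
    · rintro _ ⟨k, rfl⟩
      rw [tendsto_iff_norm_sub_tendsto_zero]
      refine squeeze_zero' (.of_forall fun _ => norm_nonneg _) ?_
        tendsto_one_div_add_atTop_nhds_zero_nat
      filter_upwards [Filter.eventually_gt_atTop k] with n hn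
      exact hTg n ⟨k, hn⟩

end ApproximatingSequence

/-! ### Rank one decompositions with controlled partial sums -/

section RankOneSums

variable {𝕜 : Type*} [RCLike 𝕜] {X : Type*} [NormedAddCommGroup X] [NormedSpace 𝕜 X]

/-- The finite rank operator `x ↦ ∑ k < n, f k x • e k`. -/
def rankOneSum (e : ℕ → X) (f : ℕ → StrongDual 𝕜 X) (n : ℕ) : X →L[𝕜] X :=
  ∑ k ∈ Finset.range n, (f k).smulRight (e k)

theorem rankOneSum_apply (e : ℕ → X) (f : ℕ → StrongDual 𝕜 X) (n : ℕ) (x : X) :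
    rankOneSum e f n x = ∑ k ∈ Finset.range n, f k x • e k := by
  simp [rankOneSum]

theorem rankOneSum_succ (e : ℕ → X) (f : ℕ → StrongDual 𝕜 X) (n : ℕ) :
    rankOneSum e f (n + 1) = rankOneSum e f n + (f n).smulRight (e n) :=
  Finset.sum_range_succ _ _

theorem ContinuousLinearMap.IsFiniteRank.exists_eq_rankOneSum [Nontrivial X] {A : X →L[𝕜] X}
    (hA : A.IsFiniteRank) :
    ∃ (m : ℕ) (e : ℕ → X) (f : ℕ → StrongDual 𝕜 X), 0 < m ∧ (∀ i < m, e i ≠ 0) ∧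
      (∀ i < m, f i ≠ 0) ∧ rankOneSum e f m = A := by
  classical
  rcases eq_or_ne A 0 with rfl | hA0
  · obtain ⟨x, hx⟩ := exists_ne (0 : X)
    obtain ⟨g, hg⟩ := SeparatingDual.exists_eq_one (R := 𝕜) hx
    -- All terms must be nonzero, so the zero operator is written as `g ⊗ x - g ⊗ x`.
    refine ⟨2, fun i => if i = 0 then x else -x, fun _ => g, two_pos, fun i _ => ?_,
      fun i _ => ?_, ?_⟩
    · dsimp only; split_ifs
      exacts [hx, neg_ne_zero.2 hx]
    · rintro rfl
      simp at hg
    · ext y; simp [rankOneSum_apply, Finset.sum_range_succ]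
  · unfold ContinuousLinearMap.IsFiniteRank at hA
    set F := LinearMap.range (A : X →ₗ[𝕜] X) with hF
    have : Module.Free 𝕜 F := Module.Free.of_divisionRing 𝕜 F
    let b := Module.finBasis 𝕜 F
    let Ar : X →L[𝕜] F := A.codRestrict F fun x => ⟨x, rfl⟩
    let ψ : Fin (Module.finrank 𝕜 F) → StrongDual 𝕜 X :=
      fun i => (LinearMap.toContinuousLinearMap (b.coord i)) ∘L Ar
    have hψ : ∀ x, ∑ i, ψ i x • (b i : X) = A x := by
      intro x
      have := congrArg (fun w : F => (w : X)) (b.sum_repr (Ar x))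
      simp only [Submodule.coe_sum, Submodule.coe_smul] at this
      exact this
    refine ⟨Module.finrank 𝕜 F, fun i => if h : i < _ then b ⟨i, h⟩ else 0,
      fun i => if h : i < _ then ψ ⟨i, h⟩ else 0, ?_, fun i hi => ?_, fun i hi => ?_, ?_⟩
    · rw [Nat.pos_iff_ne_zero]
      intro h0
      apply hA0
      have : IsEmpty (Fin (Module.finrank 𝕜 F)) := by rw [h0]; infer_instance
      ext x
      rw [← hψ x]; simp
    · simpa [hi] using b.ne_zero _
    · obtain ⟨x, hx⟩ := (b ⟨i, hi⟩).2
      simp only [hi, dif_pos]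
      intro h0
      have h1 : ψ ⟨i, hi⟩ x = 1 := by
        have : Ar x = b ⟨i, hi⟩ := Subtype.ext hx
        simp [ψ, this]
      rw [h0] at h1
      simp at h1
    · ext x
      rw [rankOneSum_apply, Finset.sum_range, ← hψ x]
      exact Finset.sum_congr rfl fun i _ => by simp

/-- A finite rank operator `A` is a sum of rank one operators whose partial sums are close to
multiples `θ • A` with `θ ∈ [0, 1]`. -/
theorem ContinuousLinearMap.IsFiniteRank.exists_rankOneSum_near [Nontrivial X] {A : X →L[𝕜] X}
    (hA : A.IsFiniteRank) {ε : ℝ} (hε : 0 < ε) :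
    ∃ (L : ℕ) (e : ℕ → X) (f : ℕ → StrongDual 𝕜 X), 0 < L ∧ (∀ i, e i ≠ 0) ∧
      (∀ i, f i ≠ 0) ∧ rankOneSum e f L = A ∧
      ∀ j ≤ L, ∃ θ : ℝ, 0 ≤ θ ∧ θ ≤ 1 ∧ ‖rankOneSum e f j - (θ : 𝕜) • A‖ ≤ ε := by
  obtain ⟨m, e, f, hm, he, hf, hsum⟩ := hA.exists_eq_rankOneSum
  obtain ⟨K, hK⟩ : ∃ K : ℝ, ∀ r < m, ‖rankOneSum e f r‖ ≤ K :=
    ⟨∑ r ∈ Finset.range m, ‖rankOneSum e f r‖, fun r hr =>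
      Finset.single_le_sum (f := fun r => ‖rankOneSum e f r‖) (fun _ _ => norm_nonneg _)
        (Finset.mem_range.2 hr)⟩
  -- The terms of `A` are repeated `M` times with weight `1 / M`: `q` periods sum to `(q / M) • A`,
  -- and an incomplete one adds at most `K / M < ε`.
  obtain ⟨M, hM⟩ := exists_nat_gt (max 1 (K / ε))
  have hM0 : (0 : ℝ) < M := by linarith [le_max_left 1 (K / ε)]
  have hM0' : 0 < M := by exact_mod_cast hM0
  have hM𝕜 : (M : 𝕜) ≠ 0 := by exact_mod_cast hM0'.ne'
  have hper : ∀ q r, r ≤ m → rankOneSum (fun j => e (j % m)) (fun j => f (j % m)) (m * q + r) =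
      (q : 𝕜) • A + rankOneSum e f r := by
    intro q
    induction q with
    | zero =>
      intro r hr
      simp only [mul_zero, zero_add, Nat.cast_zero, zero_smul]
      refine Finset.sum_congr rfl fun j hj => ?_
      simp only [Nat.mod_eq_of_lt ((Finset.mem_range.1 hj).trans_le hr)]
    | succ q ih =>
      intro r hr
      have h1 := ih m le_rfl
      rw [hsum] at h1
      have h2 : rankOneSum (fun j => e (j % m)) (fun j => f (j % m)) (m * (q + 1) + r) =
          rankOneSum (fun j => e (j % m)) (fun j => f (j % m)) (m * q + m) +
            rankOneSum e f r := by
        rw [mul_add, mul_one]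
        unfold rankOneSum
        rw [Finset.sum_range_add]
        congr 1
        refine Finset.sum_congr rfl fun j hj => ?_
        have : (m * q + m + j) % m = j := by
          rw [← Nat.mul_succ, Nat.mul_add_mod, Nat.mod_eq_of_lt]
          exact (Finset.mem_range.1 hj).trans_le hr
        simp only [this]
      rw [h2, h1]
      push_cast
      module
  have hscale : ∀ j, rankOneSum (fun j => e (j % m)) (fun j => (M : 𝕜)⁻¹ • f (j % m)) j =
      (M : 𝕜)⁻¹ • rankOneSum (fun j => e (j % m)) (fun j => f (j % m)) j := by
    intro j
    ext x
    simp [rankOneSum_apply, Finset.smul_sum, smul_smul]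
  refine ⟨m * M, fun j => e (j % m), fun j => (M : 𝕜)⁻¹ • f (j % m), by positivity,
    fun i => he _ (Nat.mod_lt _ hm), fun i => smul_ne_zero (inv_ne_zero hM𝕜)
      (hf _ (Nat.mod_lt _ hm)), ?_, fun j hj => ?_⟩
  · rw [hscale, ← add_zero (m * M), hper M 0 (Nat.zero_le _)]
    simp [rankOneSum, smul_smul, hM𝕜]
  · refine ⟨(j / m : ℕ) / (M : ℝ), by positivity, ?_, ?_⟩
    · rw [div_le_one hM0]
      exact_mod_cast Nat.div_le_of_le_mul hj
    · have h1 := hper (j / m) (j % m) (Nat.mod_lt _ hm).le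
      rw [Nat.div_add_mod] at h1
      rw [hscale, h1, smul_add, smul_smul]
      have : (((j / m : ℕ) / (M : ℝ) : ℝ) : 𝕜) = (M : 𝕜)⁻¹ * ((j / m : ℕ) : 𝕜) := by
        push_cast; rw [div_eq_inv_mul]
      rw [this, add_sub_cancel_left, norm_smul, norm_inv, RCLike.norm_natCast,
        inv_mul_le_iff₀ hM0]
      have h2 := hK _ (Nat.mod_lt j hm)
      have h3 : K / ε < M := (le_max_right _ _).trans_lt hM
      rw [div_lt_iff₀ hε] at h3
      linarith

end RankOneSums

/-! ### Concatenation of finite blocks -/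

section Concatenation

/-- The position reached after `N` steps through consecutive blocks of lengths `len 0`, `len 1`, …:
the index of the current block and the place in it. -/
def blockPosition (len : ℕ → ℕ) : ℕ → ℕ × ℕ
  | 0 => (0, 0)
  | N + 1 =>
    if (blockPosition len N).2 + 1 < len (blockPosition len N).1 then
      ((blockPosition len N).1, (blockPosition len N).2 + 1)
    else ((blockPosition len N).1 + 1, 0)

theorem blockPosition_snd_lt {len : ℕ → ℕ} (hlen : ∀ n, 0 < len n) (N : ℕ) :
    (blockPosition len N).2 < len (blockPosition len N).1 := by
  induction N with
  | zero => exact hlen 0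
  | succ N ih =>
    rw [blockPosition]
    split_ifs with h
    exacts [h, hlen _]

theorem sum_range_blockPosition {len : ℕ → ℕ} (hlen : ∀ n, 0 < len n) {M : Type*}
    [AddCommMonoid M] (F : ℕ × ℕ → M) (N : ℕ) :
    ∑ k ∈ Finset.range N, F (blockPosition len k) =
      ∑ i ∈ Finset.range (blockPosition len N).1, ∑ j ∈ Finset.range (len i), F (i, j) +
        ∑ j ∈ Finset.range (blockPosition len N).2, F ((blockPosition len N).1, j) := by
  induction N with
  | zero => simp [blockPosition]
  | succ N ih =>
    rw [Finset.sum_range_succ, ih, blockPosition]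
    split_ifs with h
    · rw [Finset.sum_range_succ, add_assoc]
    · have h' : len (blockPosition len N).1 = (blockPosition len N).2 + 1 := by
        have := blockPosition_snd_lt hlen N; omega
      rw [Finset.sum_range_succ _ (blockPosition len N).1, h', Finset.sum_range_succ,
        Finset.sum_range_zero, add_zero, add_assoc]

theorem tendsto_blockPosition_fst {len : ℕ → ℕ} (hlen : ∀ n, 0 < len n) :
    Filter.Tendsto (fun N => (blockPosition len N).1) Filter.atTop Filter.atTop := by
  rw [Filter.tendsto_atTop]
  intro B
  filter_upwards [Filter.eventually_ge_atTop (∑ i ∈ Finset.range B, len i)] with N hN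
  by_contra! hlt
  have h1 := sum_range_blockPosition hlen (fun _ => 1) N
  simp only [Finset.sum_const, Finset.card_range, smul_eq_mul, mul_one] at h1
  have h2 : ∑ i ∈ Finset.range ((blockPosition len N).1 + 1), len i ≤
      ∑ i ∈ Finset.range B, len i :=
    Finset.sum_le_sum_of_subset (Finset.range_mono hlt)
  rw [Finset.sum_range_succ] at h2
  have := blockPosition_snd_lt hlen N
  omega

end Concatenation

/-! ### Shrinking frames -/

section Frames

variable (𝕜 : Type*) [RCLike 𝕜] (X : Type*) [NormedAddCommGroup X] [NormedSpace 𝕜 X]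

/-- A shrinking Schauder frame: the finite rank operators `x ↦ ∑ k < n, f k x • e k` converge
strongly to the identity, and so do their adjoints. -/
structure ShrinkingFrame where
  /-- The vectors of the frame. -/
  vec : ℕ → X
  /-- The functionals of the frame. -/
  func : ℕ → StrongDual 𝕜 X
  -- Nonzero vectors provide coordinate functionals on the associated space; nonzero functionals
  -- keep its basis vectors bounded.
  vec_ne_zero : ∀ k, vec k ≠ 0
  func_ne_zero : ∀ k, func k ≠ 0
  tendsto_sum : ∀ x, Filter.Tendsto (fun n => rankOneSum vec func n x) Filter.atTop (nhds x)
  tendsto_comp_sum : ∀ g : StrongDual 𝕜 X,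
    Filter.Tendsto (fun n => g ∘L rankOneSum vec func n) Filter.atTop (nhds g)

variable {𝕜 X}

/-- By convexity, partial sums inside a block inherit convergence from the ends of the block. -/
theorem norm_sub_le_of_near_segment {E : Type*} [NormedAddCommGroup E] [NormedSpace 𝕜 E]
    {a b s x : E} {θ δ : ℝ} (h0 : 0 ≤ θ) (h1 : θ ≤ 1)
    (h : ‖s - (a + (θ : 𝕜) • (b - a))‖ ≤ δ) : ‖s - x‖ ≤ δ + ‖a - x‖ + ‖b - x‖ := by
  have hθ : ‖((1 - θ : ℝ) : 𝕜)‖ ≤ 1 := by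
    rw [RCLike.norm_ofReal, abs_of_nonneg (by linarith)]; linarith
  have hθ' : ‖(θ : 𝕜)‖ ≤ 1 := by
    rw [RCLike.norm_ofReal, abs_of_nonneg h0]; exact h1
  have : s - x = (s - (a + (θ : 𝕜) • (b - a))) + ((1 - θ : ℝ) : 𝕜) • (a - x) +
      (θ : 𝕜) • (b - x) := by
    push_cast
    module
  rw [this]
  refine (norm_add₃_le).trans (add_le_add (add_le_add h ?_) ?_)
  · rw [norm_smul]; exact mul_le_of_le_one_left (norm_nonneg _) hθ
  · rw [norm_smul]; exact mul_le_of_le_one_left (norm_nonneg _) hθ'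

theorem nonempty_shrinkingFrame_of_approximating_seq [Nontrivial X] (T : ℕ → X →L[𝕜] X)
    (hT : ∀ n, (T n).IsFiniteRank)
    (hTx : ∀ x, Filter.Tendsto (fun n => T n x) Filter.atTop (nhds x))
    (hTg : ∀ g : StrongDual 𝕜 X, Filter.Tendsto (fun n => g ∘L T n) Filter.atTop (nhds g)) :
    Nonempty (ShrinkingFrame 𝕜 X) := by
  -- Starting from `U 0 = 0` makes the differences telescope to `U n`.
  let U : ℕ → X →L[𝕜] X := fun n => Nat.casesOn n 0 T
  have hU : ∀ n, (U n).IsFiniteRank := by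
    rintro (_ | n)
    exacts [.zero, hT n]
  choose len e f hlen he hf hsum hnear using fun n =>
    ((hU (n + 1)).sub (hU n)).exists_rankOneSum_near (ε := 1 / ((n : ℝ) + 1)) (by positivity)
  let p := blockPosition len
  let S := rankOneSum (fun k => e (p k).1 (p k).2) (fun k => f (p k).1 (p k).2)
  have hS : ∀ N, S N = U (p N).1 + rankOneSum (e (p N).1) (f (p N).1) (p N).2 := by
    intro N
    refine (sum_range_blockPosition hlen (fun q => (f q.1 q.2).smulRight (e q.1 q.2)) N).trans ?_
    congr 1
    calc _ = ∑ i ∈ Finset.range (p N).1, (U (i + 1) - U i) :=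
          Finset.sum_congr rfl fun i _ => hsum i
      _ = U (p N).1 := by rw [Finset.sum_range_sub, show U 0 = 0 from rfl, sub_zero]
  have hidx : Filter.Tendsto (fun N => (p N).1) Filter.atTop Filter.atTop :=
    tendsto_blockPosition_fst hlen
  choose θ hθ0 hθ1 hθ using fun N => hnear (p N).1 (p N).2 (blockPosition_snd_lt hlen N).le
  have hnear' : ∀ N, ‖S N - (U (p N).1 + (θ N : 𝕜) • (U ((p N).1 + 1) - U (p N).1))‖ ≤
      1 / (((p N).1 : ℝ) + 1) := by
    intro N
    rw [hS, add_sub_add_left_eq_sub]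
    exact hθ N
  refine ⟨⟨fun k => e (p k).1 (p k).2, fun k => f (p k).1 (p k).2, fun k => he _ _,
    fun k => hf _ _, fun x => ?_, fun g => ?_⟩⟩
  · change Filter.Tendsto (fun N => S N x) _ _
    rw [tendsto_iff_norm_sub_tendsto_zero]
    have hUx : Filter.Tendsto (fun n => ‖U n x - x‖) Filter.atTop (nhds 0) := by
      rw [← tendsto_iff_norm_sub_tendsto_zero, ← Filter.tendsto_add_atTop_iff_nat 1]
      exact hTx x
    refine squeeze_zero (fun _ => norm_nonneg _) (fun N => norm_sub_le_of_near_segment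
      (a := U (p N).1 x) (b := U ((p N).1 + 1) x) (δ := 1 / (((p N).1 : ℝ) + 1) * ‖x‖) (hθ0 N)
      (hθ1 N) ((ContinuousLinearMap.le_opNorm (S N -
        (U (p N).1 + (θ N : 𝕜) • (U ((p N).1 + 1) - U (p N).1))) x).trans ?_)) (?_ : _)
    · gcongr; exact hnear' N
    · have := ((tendsto_one_div_add_atTop_nhds_zero_nat (𝕜 := ℝ)).mul_const ‖x‖).add hUx |>.add
        (hUx.comp (Filter.tendsto_add_atTop_nat 1))
      simpa [Function.comp_def] using this.comp hidx
  · change Filter.Tendsto (fun N => g ∘L S N) _ _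
    rw [tendsto_iff_norm_sub_tendsto_zero]
    have hUg : Filter.Tendsto (fun n => ‖g ∘L U n - g‖) Filter.atTop (nhds 0) := by
      rw [← tendsto_iff_norm_sub_tendsto_zero, ← Filter.tendsto_add_atTop_iff_nat 1]
      exact hTg g
    refine squeeze_zero (fun _ => norm_nonneg _) (fun N => norm_sub_le_of_near_segment
      (𝕜 := 𝕜) (E := StrongDual 𝕜 X) (a := g ∘L U (p N).1) (b := g ∘L U ((p N).1 + 1))
      (δ := ‖g‖ * (1 / (((p N).1 : ℝ) + 1)))
      (hθ0 N) (hθ1 N) (?_ : _)) (?_ : _)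
    · rw [← ContinuousLinearMap.comp_sub, ← ContinuousLinearMap.comp_smul,
        ← ContinuousLinearMap.comp_add, ← ContinuousLinearMap.comp_sub]
      refine (ContinuousLinearMap.opNorm_comp_le _ _).trans ?_
      gcongr; exact hnear' N
    · have := ((tendsto_one_div_add_atTop_nhds_zero_nat (𝕜 := ℝ)).const_mul ‖g‖).add hUg |>.add
        (hUg.comp (Filter.tendsto_add_atTop_nat 1))
      simpa [Function.comp_def] using this.comp hidx

end Frames

/-! ### Operators and functionals on `ℓ^∞(ι, X)` -/

section BoundedFamilies

open scoped ENNReal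

variable {𝕜 : Type*} [RCLike 𝕜] {ι X V : Type*} [NormedAddCommGroup X] [NormedSpace 𝕜 X]
  [NormedAddCommGroup V] [NormedSpace 𝕜 V]

/-- The operator into `ℓ^∞(ι, X)` given by a bounded family of operators. -/
noncomputable def lpInftyPi (F : ι → V →ₗ[𝕜] X) (C : ℝ) (hC : 0 ≤ C)
    (h : ∀ i v, ‖F i v‖ ≤ C * ‖v‖) : V →L[𝕜] lp (fun _ : ι => X) ∞ :=
  LinearMap.mkContinuous
    { toFun := fun v => ⟨fun i => F i v, memℓp_infty ⟨C * ‖v‖, by rintro _ ⟨i, rfl⟩; exact h i v⟩⟩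
      map_add' := fun v w => by ext i; exact map_add (F i) v w
      map_smul' := fun c v => by ext i; exact map_smul (F i) c v } C
    fun v => lp.norm_le_of_forall_le (by positivity) fun i => h i v

theorem lpInftyPi_apply (F : ι → V →ₗ[𝕜] X) (C : ℝ) (hC : 0 ≤ C)
    (h : ∀ i v, ‖F i v‖ ≤ C * ‖v‖) (v : V) (i : ι) : lpInftyPi F C hC h v i = F i v := rfl

/-- The evaluation at `i` on `ℓ^∞(ι, X)`. -/
noncomputable def lpInftyEval (i : ι) : lp (fun _ : ι => X) ∞ →L[𝕜] X :=
  lp.evalCLM 𝕜 (fun _ : ι => X) ∞ i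

theorem lpInftyEval_apply (i : ι) (z : lp (fun _ : ι => X) ∞) :
    lpInftyEval (𝕜 := 𝕜) i z = z i := rfl

theorem lpInfty_norm_apply_le (i : ι) (z : lp (fun _ : ι => X) ∞) : ‖z i‖ ≤ ‖z‖ :=
  lp.norm_apply_le_norm ENNReal.top_ne_zero z i

open scoped Classical in
/-- The restriction to `s`, extended by zero, on `ℓ^∞(ι, X)`. -/
noncomputable def lpInftyIndicator (s : Set ι) :
    lp (fun _ : ι => X) ∞ →L[𝕜] lp (fun _ : ι => X) ∞ :=
  lpInftyPi (fun i => if i ∈ s then (lpInftyEval (𝕜 := 𝕜) (X := X) i).toLinearMap else 0) 1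
    zero_le_one
    fun i z => by
      split_ifs
      · rw [one_mul]; exact lpInfty_norm_apply_le i z
      · simp

theorem lpInftyIndicator_apply_mem {s : Set ι} {i : ι} (hi : i ∈ s) (z : lp (fun _ : ι => X) ∞) :
    lpInftyIndicator (𝕜 := 𝕜) s z i = z i := by
  simp [lpInftyIndicator, lpInftyPi_apply, hi, lpInftyEval_apply]

theorem lpInftyIndicator_apply_notMem {s : Set ι} {i : ι} (hi : i ∉ s)
    (z : lp (fun _ : ι => X) ∞) : lpInftyIndicator (𝕜 := 𝕜) s z i = 0 := by
  simp [lpInftyIndicator, lpInftyPi_apply, hi]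

theorem norm_lpInftyIndicator_apply_le (s : Set ι) (z : lp (fun _ : ι => X) ∞) :
    ‖lpInftyIndicator (𝕜 := 𝕜) s z‖ ≤ ‖z‖ := by
  refine lp.norm_le_of_forall_le (norm_nonneg _) fun i => ?_
  by_cases hi : i ∈ s
  · rw [lpInftyIndicator_apply_mem hi]; exact lpInfty_norm_apply_le i z
  · rw [lpInftyIndicator_apply_notMem hi, norm_zero]; exact norm_nonneg _

/-- A functional on `ℓ^∞(ι, X)` which almost attains its norm at an element almost supported in
`s` is small on the elements supported off `s`. -/
theorem norm_comp_sub_lpInftyIndicator_le (Ψ : StrongDual 𝕜 (lp (fun _ : ι => X) ∞)) {ε : ℝ}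
    {u : lp (fun _ : ι => X) ∞} (hu : ‖u‖ ≤ 1) (hΨu : ‖Ψ‖ - ε < RCLike.re (Ψ u)) {s : Set ι}
    (hs : ‖Ψ‖ * ‖u - lpInftyIndicator (𝕜 := 𝕜) s u‖ ≤ ε) :
    ‖Ψ ∘L (ContinuousLinearMap.id 𝕜 _ - lpInftyIndicator (𝕜 := 𝕜) s)‖ ≤ 2 * ε := by
  have hε : 0 ≤ ε := (by positivity : 0 ≤ ‖Ψ‖ * _).trans hs
  refine ContinuousLinearMap.opNorm_le_of_unit_norm (by positivity) fun v hv => ?_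
  obtain ⟨c, hc, hc'⟩ := RCLike.exists_norm_eq_mul_self (Ψ (v - lpInftyIndicator (𝕜 := 𝕜) s v))
  -- The summands have disjoint supports, so the second one is added without leaving the unit ball.
  have hnorm : ‖lpInftyIndicator (𝕜 := 𝕜) s u + c • (v - lpInftyIndicator (𝕜 := 𝕜) s v)‖ ≤ 1 := by
    refine lp.norm_le_of_forall_le zero_le_one fun i => ?_
    by_cases hi : i ∈ s
    · have : (lpInftyIndicator (𝕜 := 𝕜) s u + c • (v - lpInftyIndicator (𝕜 := 𝕜) s v)) i = u i := by
        change lpInftyIndicator (𝕜 := 𝕜) s u i + c • (v i - lpInftyIndicator (𝕜 := 𝕜) s v i) = _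
        simp [lpInftyIndicator_apply_mem hi]
      rw [this]
      exact (lpInfty_norm_apply_le i u).trans hu
    · have : (lpInftyIndicator (𝕜 := 𝕜) s u + c • (v - lpInftyIndicator (𝕜 := 𝕜) s v)) i =
          c • v i := by
        change lpInftyIndicator (𝕜 := 𝕜) s u i + c • (v i - lpInftyIndicator (𝕜 := 𝕜) s v i) = _
        simp [lpInftyIndicator_apply_notMem hi]
      rw [this, norm_smul, hc, one_mul]
      exact (lpInfty_norm_apply_le i v).trans hv.le
  have h1 := (RCLike.re_le_norm _).trans
    ((Ψ.le_opNorm _).trans (mul_le_of_le_one_right (norm_nonneg Ψ) hnorm))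
  rw [map_add, map_smul, smul_eq_mul, ← hc', map_add, RCLike.ofReal_re] at h1
  have h2 : RCLike.re (Ψ u) ≤ RCLike.re (Ψ (lpInftyIndicator (𝕜 := 𝕜) s u)) + ε := by
    have := (RCLike.re_le_norm (Ψ (u - lpInftyIndicator (𝕜 := 𝕜) s u))).trans
      ((Ψ.le_opNorm _).trans hs)
    rw [map_sub, map_sub] at this
    linarith
  change ‖Ψ (v - lpInftyIndicator (𝕜 := 𝕜) s v)‖ ≤ 2 * ε
  linarith

end BoundedFamilies

/-! ### Criteria for bases and shrinking bases -/

section SchauderBases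

variable {𝕜 : Type*} [RCLike 𝕜] {E : Type*} [NormedAddCommGroup E] [NormedSpace 𝕜 E]

theorem hasSum_conditional_nat_iff {f : ℕ → E} {a : E} :
    HasSum f a (SummationFilter.conditional ℕ) ↔
      Filter.Tendsto (fun n => ∑ k ∈ Finset.range n, f k) Filter.atTop (nhds a) := by
  rw [HasSum, SummationFilter.conditional_filter_eq_map_range, Filter.tendsto_map'_iff]
  rfl

/-- A sequence with a biorthogonal sequence of functionals whose partial sum operators are bounded
on its closed span is a Schauder basis of its closed span. -/
noncomputable def SchauderBasis.ofBiorthogonal (ζ : ℕ → E) (c : ℕ → StrongDual 𝕜 E)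
    (hc : ∀ i j, c i (ζ j) = if i = j then 1 else 0) (K : ℝ)
    (hK : ∀ n, ∀ z ∈ (Submodule.span 𝕜 (Set.range ζ)).topologicalClosure,
      ‖∑ k ∈ Finset.range n, c k z • ζ k‖ ≤ K * ‖z‖) :
    SchauderBasis 𝕜 (Submodule.span 𝕜 (Set.range ζ)).topologicalClosure where
  basis k := ⟨ζ k, Submodule.le_topologicalClosure _ (Submodule.subset_span ⟨k, rfl⟩)⟩
  coord k := c k ∘L Submodule.subtypeL _
  ortho i j := by
    refine (hc i j).trans ?_
    simp [Pi.single_apply]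
  expansion z := by
    rw [hasSum_conditional_nat_iff, tendsto_subtype_rng]
    have key := tendsto_id_of_mem_closure (E := E)
      (F := fun n z => ∑ k ∈ Finset.range n, c k z • ζ k) (K := K)
      (s := Submodule.span 𝕜 (Set.range ζ)) (x := z) (fun n y hy => ?_) (fun y hy => ?_) z.2
    · simpa using key
    · rw [← Finset.sum_sub_distrib]
      simp only [← sub_smul, ← map_sub]
      exact hK n _ (Submodule.sub_mem _ z.2 (Submodule.le_topologicalClosure _ hy))
    · induction hy using Submodule.span_induction with
      | mem y hy =>
        obtain ⟨j, rfl⟩ := hy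
        refine tendsto_const_nhds.congr' ?_
        filter_upwards [Filter.eventually_gt_atTop j] with n hn
        simp [hc, hn]
      | zero => simp
      | add y z _ _ hy hz =>
        refine (hy.add hz).congr fun n => ?_
        simp [add_smul, Finset.sum_add_distrib]
      | smul a y _ hy =>
        refine (hy.const_smul a).congr fun n => ?_
        simp [Finset.smul_sum, smul_smul]

/-- A Schauder basis is shrinking when the adjoints of its partial sum projections converge
strongly to the identity. -/
theorem SchauderBasis.isShrinking_of_norm_apply_sub_le (b : SchauderBasis 𝕜 E)
    (h : ∀ φ : StrongDual 𝕜 E, ∀ ε : ℝ, 0 < ε →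
      ∃ M, ∀ m ≥ M, ∀ z, ‖φ (z - b.proj m z)‖ ≤ ε * ‖z‖) :
    b.IsShrinking := by
  have hlim : ∀ φ : StrongDual 𝕜 E,
      Filter.Tendsto (fun n => φ ∘L b.proj n) Filter.atTop (nhds φ) := by
    intro φ
    rw [Metric.tendsto_atTop]
    intro ε hε
    obtain ⟨M, hM⟩ := h φ (ε / 2) (by positivity)
    refine ⟨M, fun m hm => ?_⟩
    rw [dist_comm, dist_eq_norm]
    refine lt_of_le_of_lt (ContinuousLinearMap.opNorm_le_bound _ (by positivity) fun z => ?_)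
      (half_lt_self hε)
    rw [sub_apply, ContinuousLinearMap.comp_apply, ← map_sub]
    exact hM m hm z
  refine ⟨⟨b.coord, fun k => NormedSpace.inclusionInDoubleDual 𝕜 E (b k), fun i j => ?_,
    fun φ => ?_⟩, rfl⟩
  · rw [NormedSpace.dual_def, b.ortho]
    simp [Pi.single_apply, eq_comm]
  · rw [hasSum_conditional_nat_iff]
    refine (hlim φ).congr fun n => ?_
    ext z
    simp [mul_comm]

end SchauderBases

/-! ### The space with a basis associated to a frame -/

namespace ShrinkingFrame

open scoped ENNReal
open Filter

variable {𝕜 : Type u} [RCLike 𝕜] {X : Type v} [NormedAddCommGroup X] [NormedSpace 𝕜 X]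
  (Φ : ShrinkingFrame 𝕜 X)

/-- The partial sum operators of a frame. -/
noncomputable def sum (n : ℕ) : X →L[𝕜] X := rankOneSum Φ.vec Φ.func n

theorem sum_succ_sub (n : ℕ) : Φ.sum (n + 1) - Φ.sum n = (Φ.func n).smulRight (Φ.vec n) := by
  rw [sum, sum, rankOneSum_succ, add_sub_cancel_left]

theorem sum_zero : Φ.sum 0 = 0 := by simp [sum, rankOneSum]

theorem exists_norm_sum_le [CompleteSpace X] : ∃ D : ℝ, ∀ n, ‖Φ.sum n‖ ≤ D := by
  refine banach_steinhaus fun x => ?_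
  obtain ⟨M, hM⟩ := isBounded_iff_forall_norm_le.mp
    (Metric.isBounded_range_of_tendsto (fun n => Φ.sum n x) (Φ.tendsto_sum x))
  exact ⟨M, Set.forall_mem_range.mp hM⟩

/-- The index set of the space associated to a frame: pairs of an operator `R` and a starting point
`r` such that the sums of the frame over intervals beyond `r`, followed by `R`, have norm at most
`‖R‖⁻¹`. -/
structure Index : Type (max u v w) where
  /-- The operator. -/
  op : X →L[𝕜] X
  /-- The starting point. -/
  start : ULift.{max u w} ℕ
  norm_mul_le : ∀ s t, start.down ≤ s → s ≤ t → ‖op‖ * ‖op ∘L (Φ.sum t - Φ.sum s)‖ ≤ 1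

/-- Bounded families over the index set of a frame; the associated space is a subspace of it. -/
abbrev Ambient : Type (max u v w) := lp (fun _ : Index.{u, v, w} Φ => X) ∞

variable {Φ}

/-- Admissibility for the single term `k`: a large `‖i.op‖` forces `i.op (Φ.vec k)` to be small. -/
theorem Index.norm_mul_norm_mul_le (i : Index.{u, v, w} Φ) {k : ℕ} (hk : i.start.down ≤ k) :
    ‖i.op‖ * (‖Φ.func k‖ * ‖i.op (Φ.vec k)‖) ≤ 1 := by
  have h := i.norm_mul_le k (k + 1) hk (Nat.le_succ k)
  have h' : i.op ∘L (Φ.func k).smulRight (Φ.vec k) = (Φ.func k).smulRight (i.op (Φ.vec k)) := by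
    ext x; simp
  rwa [sum_succ_sub, h', ContinuousLinearMap.norm_smulRight_apply] at h

/-- Move the starting point to the right. -/
def Index.shift (i : Index.{u, v, w} Φ) (m : ℕ) : Index.{u, v, w} Φ where
  op := i.op
  start := ⟨max i.start.down m⟩
  norm_mul_le s t hs ht := i.norm_mul_le s t ((le_max_left _ _).trans hs) ht

/-- With `w = x - Φ.sum m x`, letting `t → ∞` in the admissibility condition gives `‖R‖ ‖R w‖ ≤
‖x‖`; multiply by `‖w‖`. The resulting bound does not involve `‖R‖`. -/
theorem Index.sq_norm_apply_sub_le (i : Index.{u, v, w} Φ) {m : ℕ} (hm : i.start.down ≤ m)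
    (x : X) : ‖i.op (x - Φ.sum m x)‖ ^ 2 ≤ ‖x‖ * ‖x - Φ.sum m x‖ := by
  have h1 : ‖i.op‖ * ‖i.op (x - Φ.sum m x)‖ ≤ ‖x‖ := by
    have hlim : Tendsto (fun t => ‖i.op‖ * ‖i.op (Φ.sum t x - Φ.sum m x)‖) atTop
        (nhds (‖i.op‖ * ‖i.op (x - Φ.sum m x)‖)) :=
      (((i.op.continuous.tendsto _).comp ((Φ.tendsto_sum x).sub_const _)).norm).const_mul _
    refine le_of_tendsto hlim ?_
    filter_upwards [eventually_ge_atTop m] with t ht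
    calc ‖i.op‖ * ‖i.op (Φ.sum t x - Φ.sum m x)‖
        ≤ ‖i.op‖ * (‖i.op ∘L (Φ.sum t - Φ.sum m)‖ * ‖x‖) := by
          gcongr; exact (i.op ∘L (Φ.sum t - Φ.sum m)).le_opNorm x
      _ = (‖i.op‖ * ‖i.op ∘L (Φ.sum t - Φ.sum m)‖) * ‖x‖ := by ring
      _ ≤ 1 * ‖x‖ := by gcongr; exact i.norm_mul_le m t hm ht
      _ = ‖x‖ := one_mul _
  calc ‖i.op (x - Φ.sum m x)‖ ^ 2
      ≤ (‖i.op‖ * ‖x - Φ.sum m x‖) * ‖i.op (x - Φ.sum m x)‖ := by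
        rw [sq]; gcongr; exact i.op.le_opNorm _
    _ = (‖i.op‖ * ‖i.op (x - Φ.sum m x)‖) * ‖x - Φ.sum m x‖ := by ring
    _ ≤ ‖x‖ * ‖x - Φ.sum m x‖ := by gcongr

variable (Φ)

theorem vec_bound_nonneg (k : ℕ) : 0 ≤ ‖Φ.vec k‖ + ‖Φ.func k‖⁻¹ := by positivity

theorem norm_ite_op_apply_vec_le (k : ℕ) (i : Index.{u, v, w} Φ) :
    ‖if i.start.down ≤ k then i.op (Φ.vec k) else 0‖ ≤ ‖Φ.vec k‖ + ‖Φ.func k‖⁻¹ := by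
  have hf : 0 < ‖Φ.func k‖ := norm_pos_iff.2 (Φ.func_ne_zero k)
  split_ifs with hk
  · rcases le_total ‖i.op‖ 1 with h | h
    · have h1 : ‖i.op (Φ.vec k)‖ ≤ ‖Φ.vec k‖ :=
        (i.op.le_opNorm _).trans (mul_le_of_le_one_left (norm_nonneg _) h)
      linarith [inv_pos.2 hf]
    · have h1 : ‖Φ.func k‖ * ‖i.op (Φ.vec k)‖ ≤ 1 :=
        (le_mul_of_one_le_left (by positivity) h).trans (i.norm_mul_norm_mul_le hk)
      have h2 : ‖i.op (Φ.vec k)‖ ≤ ‖Φ.func k‖⁻¹ := by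
        rw [← one_div, le_div_iff₀ hf]; linarith
      linarith [norm_nonneg (Φ.vec k)]
  · rw [norm_zero]; exact Φ.vec_bound_nonneg k

/-- The basis vectors of the associated space. -/
noncomputable def basisVec (k : ℕ) : Ambient.{u, v, w} Φ :=
  ⟨fun i => if i.start.down ≤ k then i.op (Φ.vec k) else 0,
    memℓp_infty ⟨‖Φ.vec k‖ + ‖Φ.func k‖⁻¹, by
      rintro _ ⟨i, rfl⟩; exact Φ.norm_ite_op_apply_vec_le k i⟩⟩

theorem basisVec_apply (k : ℕ) (i : Index.{u, v, w} Φ) :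
    Φ.basisVec k i = if i.start.down ≤ k then i.op (Φ.vec k) else 0 := rfl

/-- The Banach space associated to a frame. -/
noncomputable abbrev AssocSpace : Submodule 𝕜 (Ambient.{u, v, w} Φ) :=
  (Submodule.span 𝕜 (Set.range (basisVec.{u, v, w} Φ))).topologicalClosure

theorem basisVec_mem (k : ℕ) : Φ.basisVec k ∈ AssocSpace.{u, v, w} Φ :=
  Submodule.le_topologicalClosure _ (Submodule.subset_span ⟨k, rfl⟩)

variable {Φ} in
theorem eq_of_eq_basisVec {E : Type*} [NormedAddCommGroup E] [NormedSpace 𝕜 E]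
    {S T : Ambient.{u, v, w} Φ →L[𝕜] E} (h : ∀ k, S (Φ.basisVec k) = T (Φ.basisVec k))
    {z : Ambient.{u, v, w} Φ} (hz : z ∈ AssocSpace.{u, v, w} Φ) : S z = T z :=
  ContinuousLinearMap.eqOn_closure_span (s := Set.range (basisVec.{u, v, w} Φ))
    (by rintro _ ⟨k, rfl⟩; exact h k) hz

theorem exists_func_vec_eq_one (k : ℕ) : ∃ h : StrongDual 𝕜 X, h (Φ.vec k) = 1 :=
  SeparatingDual.exists_eq_one (Φ.vec_ne_zero k)

theorem norm_apply_sub_sum_le {D : ℝ} (hD : ∀ n, ‖Φ.sum n‖ ≤ D) (i : Index.{u, v, w} Φ) (x : X) :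
    ‖i.op (x - Φ.sum i.start.down x)‖ ≤ (1 + D) * ‖x‖ := by
  have hD0 : 0 ≤ D := (norm_nonneg _).trans (hD 0)
  have h1 : ‖x - Φ.sum i.start.down x‖ ≤ (1 + D) * ‖x‖ := by
    have := (Φ.sum i.start.down).le_of_opNorm_le (hD _) x
    linarith [norm_sub_le x (Φ.sum i.start.down x)]
  refine abs_le_of_sq_le_sq' ?_ (by positivity) |>.2
  calc _ ≤ ‖x‖ * ‖x - Φ.sum i.start.down x‖ := i.sq_norm_apply_sub_le le_rfl x
    _ ≤ ‖x‖ * ((1 + D) * ‖x‖) := by gcongr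
    _ ≤ ((1 + D) * ‖x‖) * ((1 + D) * ‖x‖) := by
      gcongr
      exact le_mul_of_one_le_left (norm_nonneg _) (by linarith)
    _ = ((1 + D) * ‖x‖) ^ 2 := by ring

variable [CompleteSpace X]

theorem exists_scale : ∃ c : ℝ, 0 < c ∧ ∀ s t, c * (c * ‖Φ.sum t - Φ.sum s‖) ≤ 1 := by
  obtain ⟨D, hD⟩ := Φ.exists_norm_sum_le
  have hD0 : 0 ≤ D := (norm_nonneg _).trans (hD 0)
  refine ⟨1 / (1 + 2 * D), by positivity, fun s t => ?_⟩
  have h1 : ‖Φ.sum t - Φ.sum s‖ ≤ 1 + 2 * D := by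
    linarith [norm_sub_le (Φ.sum t) (Φ.sum s), hD t, hD s]
  have h2 : 1 / (1 + 2 * D) * ‖Φ.sum t - Φ.sum s‖ ≤ 1 := by
    rw [one_div_mul_eq_div, div_le_one (by positivity)]; exact h1
  have h3 : 1 / (1 + 2 * D) ≤ 1 := by rw [div_le_one (by positivity)]; linarith
  exact mul_le_one₀ h3 (by positivity) h2

/-- A positive multiple of the identity with this factor belongs to the index set. -/
noncomputable def scale : ℝ := Φ.exists_scale.choose

theorem scale_pos : 0 < Φ.scale := Φ.exists_scale.choose_spec.1

theorem scale_ne_zero : (Φ.scale : 𝕜) ≠ 0 := by exact_mod_cast Φ.scale_pos.ne'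

/-- The multiple of the identity in the index set, with starting point `r`. -/
noncomputable def idIndex (r : ℕ) : Index.{u, v, w} Φ where
  op := (Φ.scale : 𝕜) • ContinuousLinearMap.id 𝕜 X
  start := ⟨r⟩
  norm_mul_le s t _ _ := by
    have h1 : ‖(Φ.scale : 𝕜) • ContinuousLinearMap.id 𝕜 X‖ ≤ Φ.scale := by
      rw [norm_smul, RCLike.norm_ofReal, abs_of_pos Φ.scale_pos]
      exact mul_le_of_le_one_right Φ.scale_pos.le ContinuousLinearMap.norm_id_le
    rw [ContinuousLinearMap.smul_comp, ContinuousLinearMap.id_comp, norm_smul _ (_ - _),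
      RCLike.norm_ofReal, abs_of_pos Φ.scale_pos]
    refine le_trans ?_ (Φ.exists_scale.choose_spec.2 s t)
    exact mul_le_mul_of_nonneg_right h1 (mul_nonneg Φ.scale_pos.le (norm_nonneg _))

/-- The sum `∑ k ≥ r, a k • Φ.vec k` of the tail of an element `∑ k, a k • Φ.basisVec k`. -/
noncomputable def tail (r : ℕ) : Ambient.{u, v, w} Φ →L[𝕜] X :=
  (Φ.scale : 𝕜)⁻¹ • lpInftyEval (Φ.idIndex r)

theorem tail_apply (r : ℕ) (z : Ambient.{u, v, w} Φ) :
    Φ.tail r z = (Φ.scale : 𝕜)⁻¹ • z (Φ.idIndex r) := rfl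

theorem tail_basisVec (r k : ℕ) :
    Φ.tail r (basisVec.{u, v, w} Φ k) = if r ≤ k then Φ.vec k else 0 := by
  rw [tail_apply, basisVec_apply]
  change _ • (if r ≤ k then (Φ.scale : 𝕜) • Φ.vec k else 0) = _
  split_ifs
  · rw [inv_smul_smul₀ Φ.scale_ne_zero]
  · rw [smul_zero]

variable {Φ} in
-- Both sides are continuous in `z` and agree on the basis vectors.
theorem apply_eq_op_tail {z : Ambient.{u, v, w} Φ} (hz : z ∈ AssocSpace.{u, v, w} Φ)
    (i : Index.{u, v, w} Φ) : z i = i.op (Φ.tail i.start.down z) := by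
  refine eq_of_eq_basisVec (S := lpInftyEval i) (T := i.op ∘L Φ.tail i.start.down)
    (fun k => ?_) hz
  rw [ContinuousLinearMap.comp_apply, tail_basisVec, lpInftyEval_apply, basisVec_apply]
  split_ifs <;> simp

/-- The coordinate functionals of the associated space, extended to the ambient space. -/
noncomputable def coord (k : ℕ) : StrongDual 𝕜 (Ambient.{u, v, w} Φ) :=
  -- The difference of consecutive tails is `a k • Φ.vec k`.
  (Φ.exists_func_vec_eq_one k).choose ∘L (Φ.tail k - Φ.tail (k + 1))

theorem coord_basisVec (i j : ℕ) :
    Φ.coord i (basisVec.{u, v, w} Φ j) = if i = j then 1 else 0 := by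
  simp only [coord, ContinuousLinearMap.comp_apply, sub_apply, tail_basisVec]
  rcases lt_trichotomy i j with h | rfl | h
  · simp [h.le, Nat.succ_le_of_lt h, h.ne]
  · simpa using (Φ.exists_func_vec_eq_one i).choose_spec
  · simp [h.not_ge, (h.trans (Nat.lt_succ_self i)).not_ge, h.ne']

/-- The partial sum operators on the ambient space. -/
noncomputable def partialSum (n : ℕ) : Ambient.{u, v, w} Φ →L[𝕜] Ambient.{u, v, w} Φ :=
  ∑ k ∈ Finset.range n, (Φ.coord k).smulRight (Φ.basisVec k)

theorem partialSum_apply (n : ℕ) (z : Ambient.{u, v, w} Φ) :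
    Φ.partialSum n z = ∑ k ∈ Finset.range n, Φ.coord k z • Φ.basisVec k := by
  simp [partialSum]

theorem partialSum_basisVec (n k : ℕ) :
    Φ.partialSum n (basisVec.{u, v, w} Φ k) = if k < n then Φ.basisVec k else 0 := by
  simp [partialSum_apply, coord_basisVec]

theorem partialSum_mem (n : ℕ) (z : Ambient.{u, v, w} Φ) :
    Φ.partialSum n z ∈ AssocSpace.{u, v, w} Φ := by
  rw [partialSum_apply]
  exact Submodule.sum_mem _ fun k _ => Submodule.smul_mem _ _ (Φ.basisVec_mem k)

variable {Φ} in
-- Deleting the first `n` terms amounts to moving starting points to the right, which preserves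
-- admissibility; hence remainders are contractive.
theorem sub_partialSum_apply (n : ℕ) {z : Ambient.{u, v, w} Φ}
    (hz : z ∈ AssocSpace.{u, v, w} Φ) (i : Index.{u, v, w} Φ) :
    (z - Φ.partialSum n z) i = z (i.shift n) := by
  refine eq_of_eq_basisVec (S := lpInftyEval i ∘L (ContinuousLinearMap.id 𝕜 _ - Φ.partialSum n))
    (T := lpInftyEval (i.shift n)) (fun k => ?_) hz
  change (Φ.basisVec k - Φ.partialSum n (Φ.basisVec k)) i =
    if max i.start.down n ≤ k then i.op (Φ.vec k) else 0
  rw [partialSum_basisVec]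
  split_ifs with h1 h2 h2
  · omega
  · rw [sub_self]; rfl
  · rw [sub_zero, basisVec_apply, if_pos (le_of_max_le_left h2)]
  · rw [sub_zero, basisVec_apply, if_neg (by omega)]

variable {Φ} in
theorem norm_sub_partialSum_le (n : ℕ) {z : Ambient.{u, v, w} Φ}
    (hz : z ∈ AssocSpace.{u, v, w} Φ) : ‖z - Φ.partialSum n z‖ ≤ ‖z‖ :=
  lp.norm_le_of_forall_le (norm_nonneg _) fun i => by
    rw [sub_partialSum_apply n hz]; exact lpInfty_norm_apply_le _ z

variable {Φ} in
theorem tail_sub_partialSum (r n : ℕ) {z : Ambient.{u, v, w} Φ}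
    (hz : z ∈ AssocSpace.{u, v, w} Φ) :
    Φ.tail r (z - Φ.partialSum n z) = Φ.tail (max r n) z := by
  rw [tail_apply, sub_partialSum_apply n hz]
  rfl

/-- The canonical basis of the associated space. -/
noncomputable def basis : SchauderBasis 𝕜 (AssocSpace.{u, v, w} Φ) :=
  -- A partial sum is `z` minus a contractive remainder, whence the constant `2`.
  SchauderBasis.ofBiorthogonal Φ.basisVec Φ.coord (coord_basisVec.{u, v, w} Φ) 2 fun n z hz => by
    rw [← partialSum_apply]
    have h := norm_sub_partialSum_le n hz
    have h2 := norm_sub_le z (z - Φ.partialSum n z)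
    rw [sub_sub_cancel] at h2
    linarith

theorem basis_proj_apply (n : ℕ) (z : AssocSpace.{u, v, w} Φ) :
    (Φ.basis.proj n z : Ambient.{u, v, w} Φ) = Φ.partialSum n z := by
  rw [SchauderBasis.proj_apply, partialSum_apply, Submodule.coe_sum]
  rfl

theorem one_add_choose_nonneg : 0 ≤ 1 + Φ.exists_norm_sum_le.choose := by
  linarith [(norm_nonneg _).trans (Φ.exists_norm_sum_le.choose_spec 0)]

/-- The analysis operator `x ↦ ∑ k, Φ.func k x • Φ.basisVec k`. -/
noncomputable def analysis : X →L[𝕜] Ambient.{u, v, w} Φ :=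
  lpInftyPi (fun i => (i.op ∘L (ContinuousLinearMap.id 𝕜 X - Φ.sum i.start.down)).toLinearMap)
    (1 + Φ.exists_norm_sum_le.choose) Φ.one_add_choose_nonneg
    (Φ.norm_apply_sub_sum_le Φ.exists_norm_sum_le.choose_spec)

theorem analysis_apply (x : X) (i : Index.{u, v, w} Φ) :
    Φ.analysis x i = i.op (x - Φ.sum i.start.down x) := rfl

theorem analysis_sub_sum_apply (x : X) (N : ℕ) (i : Index.{u, v, w} Φ) :
    (Φ.analysis x - ∑ k ∈ Finset.range N, Φ.func k x • Φ.basisVec k) i =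
      i.op (x - Φ.sum (max i.start.down N) x) := by
  induction N with
  | zero => simp [analysis_apply]
  | succ N ih =>
    rw [Finset.sum_range_succ, ← sub_sub]
    change (Φ.analysis x - ∑ k ∈ Finset.range N, Φ.func k x • Φ.basisVec k) i -
      Φ.func N x • (if i.start.down ≤ N then i.op (Φ.vec N) else 0) = _
    rw [ih]
    split_ifs with h
    · rw [max_eq_right h, max_eq_right (h.trans (Nat.le_succ N)), ← map_smul, ← map_sub, sub_sub]
      have := congrArg (fun T : X →L[𝕜] X => T x) (Φ.sum_succ_sub N)
      simp only [sub_apply, ContinuousLinearMap.smulRight_apply] at this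
      rw [← this, add_sub_cancel]
    · rw [smul_zero, sub_zero, max_eq_left (by omega), max_eq_left (by omega)]

/-- The remainders of the series for `Φ.analysis x` are small uniformly in the index by
`Index.sq_norm_apply_sub_le`, whose square explains the tolerance of order `ε ^ 2`. -/
theorem analysis_mem (x : X) : Φ.analysis x ∈ AssocSpace.{u, v, w} Φ := by
  refine Metric.mem_closure_iff.2 fun ε hε => ?_
  obtain ⟨N, hN⟩ := Metric.tendsto_atTop.1 (Φ.tendsto_sum x) ((ε / 2) ^ 2 / (‖x‖ + 1))
    (by positivity)
  refine ⟨∑ k ∈ Finset.range N, Φ.func k x • Φ.basisVec k,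
    Submodule.sum_mem _ fun k _ => Submodule.smul_mem _ _ (Submodule.subset_span ⟨k, rfl⟩), ?_⟩
  rw [dist_eq_norm]
  refine lt_of_le_of_lt (lp.norm_le_of_forall_le (C := ε / 2) (by positivity) fun i => ?_)
    (half_lt_self hε)
  rw [analysis_sub_sum_apply]
  refine abs_le_of_sq_le_sq' ?_ (by positivity) |>.2
  have h1 := hN (max i.start.down N) (le_max_right _ _)
  rw [dist_comm, dist_eq_norm] at h1
  calc _ ≤ ‖x‖ * ‖x - Φ.sum (max i.start.down N) x‖ := i.sq_norm_apply_sub_le (le_max_left _ _) x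
    _ ≤ ‖x‖ * ((ε / 2) ^ 2 / (‖x‖ + 1)) := by gcongr; exact h1.le
    _ ≤ (ε / 2) ^ 2 := by
      rw [mul_div_assoc', div_le_iff₀ (by positivity)]
      nlinarith [sq_nonneg (ε / 2)]

theorem tail_zero_analysis (x : X) : Φ.tail 0 (analysis.{u, v, w} Φ x) = x := by
  rw [tail_apply, analysis_apply]
  change _ • (Φ.scale : 𝕜) • (x - Φ.sum 0 x) = x
  rw [inv_smul_smul₀ Φ.scale_ne_zero, sum_zero, zero_apply, sub_zero]

theorem embedsComplementably : EmbedsComplementably 𝕜 X (AssocSpace.{u, v, w} Φ) := by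
  let i : X →L[𝕜] AssocSpace.{u, v, w} Φ := Φ.analysis.codRestrict _ Φ.analysis_mem
  let p : AssocSpace.{u, v, w} Φ →L[𝕜] X := Φ.tail 0 ∘L Submodule.subtypeL _
  have hpi : Function.LeftInverse p i := tail_zero_analysis.{u, v, w} Φ
  have hi : i.HasLeftInverse := ⟨p, hpi⟩
  refine ⟨LinearMap.range i.toLinearMap, hi.closedComplemented_range, ⟨?_⟩⟩
  refine ContinuousLinearEquiv.equivOfInverse (i.codRestrict _ fun x => ⟨x, rfl⟩)
    (p ∘L Submodule.subtypeL _) hpi ?_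
  rintro ⟨_, x, rfl⟩
  exact Subtype.ext (congrArg i (hpi x))

end ShrinkingFrame

/-! ### The basis of the associated space is shrinking -/

namespace ShrinkingFrame

open scoped ENNReal
open Filter

variable {𝕜 : Type u} [RCLike 𝕜] {X : Type v} [NormedAddCommGroup X] [NormedSpace 𝕜 X]
  (Φ : ShrinkingFrame 𝕜 X)

/-- The indices with starting point and operator norm at most `n`. -/
def cutoff (n : ℕ) : Set (Index.{u, v, w} Φ) := {i | i.start.down ≤ n ∧ ‖i.op‖ ≤ n}

/-- Off the cutoff, either the start exceeds `k` and the entry is zero, or `‖R‖ > n` and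
admissibility makes it small. -/
theorem norm_basisVec_sub_indicator_le {n k : ℕ} (hk : k < n) :
    ‖basisVec.{u, v, w} Φ k - lpInftyIndicator (𝕜 := 𝕜) (Φ.cutoff n) (Φ.basisVec k)‖ ≤
      ‖Φ.func k‖⁻¹ / n := by
  have hf : 0 < ‖Φ.func k‖ := norm_pos_iff.2 (Φ.func_ne_zero k)
  refine lp.norm_le_of_forall_le (by positivity) fun i => ?_
  change ‖Φ.basisVec k i - lpInftyIndicator (𝕜 := 𝕜) (Φ.cutoff n) (Φ.basisVec k) i‖ ≤ _
  by_cases hi : i ∈ Φ.cutoff n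
  · rw [lpInftyIndicator_apply_mem hi, sub_self, norm_zero]; positivity
  rw [lpInftyIndicator_apply_notMem hi, sub_zero, basisVec_apply]
  split_ifs with hik
  · have hn : (n : ℝ) < ‖i.op‖ := by
      by_contra! h
      exact hi ⟨hik.trans hk.le, h⟩
    have hn0 : (0 : ℝ) < n := by exact_mod_cast (Nat.zero_le k).trans_lt hk
    have h1 := i.norm_mul_norm_mul_le hik
    rw [le_div_iff₀ hn0, ← one_div, le_div_iff₀ hf]
    calc ‖i.op (Φ.vec k)‖ * n * ‖Φ.func k‖ = n * (‖Φ.func k‖ * ‖i.op (Φ.vec k)‖) := by ring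
      _ ≤ ‖i.op‖ * (‖Φ.func k‖ * ‖i.op (Φ.vec k)‖) := by gcongr
      _ ≤ 1 := h1
  · rw [norm_zero]; positivity

theorem tendsto_indicator_cutoff {z : Ambient.{u, v, w} Φ} (hz : z ∈ AssocSpace.{u, v, w} Φ) :
    Tendsto (fun n => lpInftyIndicator (𝕜 := 𝕜) (Φ.cutoff n) z) atTop (nhds z) := by
  refine tendsto_id_of_mem_closure (F := fun n z => lpInftyIndicator (𝕜 := 𝕜) (Φ.cutoff n) z)
    (K := 1) (s := (Submodule.span 𝕜 (Set.range (basisVec.{u, v, w} Φ)) :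
      Set (Ambient.{u, v, w} Φ)))
    (fun n y _ => ?_) (fun y hy => ?_) hz
  · rw [← map_sub, one_mul]
    exact norm_lpInftyIndicator_apply_le _ _
  · induction hy using Submodule.span_induction with
    | mem y hy =>
      obtain ⟨k, rfl⟩ := hy
      rw [tendsto_iff_norm_sub_tendsto_zero]
      refine squeeze_zero' (.of_forall fun _ => norm_nonneg _) ?_
        (tendsto_const_div_atTop_nhds_zero_nat ‖Φ.func k‖⁻¹)
      filter_upwards [eventually_gt_atTop k] with n hn
      rw [norm_sub_rev]
      exact Φ.norm_basisVec_sub_indicator_le hn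
    | zero => simp
    | add y z _ _ hy hz => simpa using hy.add hz
    | smul a y _ hy => simpa using hy.const_smul a

open scoped Classical in
/-- The operator placing `R x` at the indices of `Φ.cutoff n` with operator `R` and starting
point `r`. -/
noncomputable def place (n r : ℕ) : X →L[𝕜] Ambient.{u, v, w} Φ :=
  lpInftyPi (fun i => if i.start.down = r ∧ i ∈ Φ.cutoff n then i.op.toLinearMap else 0) n
    n.cast_nonneg fun i x => by
      split_ifs with h
      · exact i.op.le_of_opNorm_le h.2.2 x
      · simpa using by positivity

theorem place_apply_of_mem {n : ℕ} {i : Index.{u, v, w} Φ} (hi : i ∈ Φ.cutoff n) (r : ℕ) (x : X) :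
    Φ.place n r x i = if i.start.down = r then i.op x else 0 := by
  rw [place, lpInftyPi_apply]
  simp only [hi, and_true]
  split_ifs <;> rfl

theorem place_apply_of_notMem {n : ℕ} {i : Index.{u, v, w} Φ} (hi : i ∉ Φ.cutoff n) (r : ℕ)
    (x : X) : Φ.place n r x i = 0 := by
  rw [place, lpInftyPi_apply]
  simp [hi]

variable [CompleteSpace X]

/-- Only the starts `0, …, n` occur in the cutoff, so the restriction depends on `z` through
finitely many tails. -/
theorem indicator_cutoff_eq_sum (n : ℕ) {z : Ambient.{u, v, w} Φ}
    (hz : z ∈ AssocSpace.{u, v, w} Φ) :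
    lpInftyIndicator (𝕜 := 𝕜) (Φ.cutoff n) z =
      ∑ r ∈ Finset.range (n + 1), Φ.place n r (Φ.tail r z) := by
  ext i
  have hsum : (∑ r ∈ Finset.range (n + 1), Φ.place n r (Φ.tail r z)) i =
      ∑ r ∈ Finset.range (n + 1), Φ.place n r (Φ.tail r z) i :=
    map_sum (lpInftyEval (𝕜 := 𝕜) i) _ _
  rw [hsum]
  by_cases hi : i ∈ Φ.cutoff n
  · simp only [Φ.place_apply_of_mem hi]
    rw [lpInftyIndicator_apply_mem hi, apply_eq_op_tail hz, Finset.sum_ite_eq,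
      if_pos (Finset.mem_range.2 (Nat.lt_succ_of_le hi.1))]
  · simp only [Φ.place_apply_of_notMem hi]
    rw [lpInftyIndicator_apply_notMem hi, Finset.sum_const_zero]

/-- Functionals of the base space, applied to the sum of the tail, tend to zero uniformly on
bounded sets of the associated space. -/
theorem exists_norm_apply_tail_le (h : StrongDual 𝕜 X) {δ : ℝ} (hδ : 0 < δ) :
    ∃ M, ∀ m ≥ M, ∀ z ∈ AssocSpace.{u, v, w} Φ, ‖h (Φ.tail m z)‖ ≤ δ * ‖z‖ := by
  have he : 0 < ‖Φ.vec 0‖ := norm_pos_iff.2 (Φ.vec_ne_zero 0)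
  obtain ⟨M, hM⟩ := Metric.tendsto_atTop.1 (Φ.tendsto_comp_sum h) (δ ^ 2 / (2 * (‖h‖ + 1)))
    (by positivity)
  -- The length `δ⁻¹` turns the entry of `z` at `h ⊗ y` into the desired bound. Admissibility from
  -- `m` on costs `‖h‖ δ⁻²` times a variation of `h ∘L Φ.sum` of at most `δ ^ 2 / (‖h‖ + 1)`.
  let y : X := ((δ⁻¹ * ‖Φ.vec 0‖⁻¹ : ℝ) : 𝕜) • Φ.vec 0
  have hy : ‖y‖ = δ⁻¹ := by
    rw [norm_smul, RCLike.norm_ofReal, abs_of_nonneg (by positivity), mul_assoc,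
      inv_mul_cancel₀ he.ne', mul_one]
  refine ⟨M, fun m hm z hz => ?_⟩
  let i : Index.{u, v, w} Φ :=
    { op := h.smulRight y
      start := ⟨m⟩
      norm_mul_le := fun s t hs ht => by
        have h1 : h.smulRight y ∘L (Φ.sum t - Φ.sum s) =
            (h ∘L Φ.sum t - h ∘L Φ.sum s).smulRight y := by
          ext x; simp [sub_smul]
        have h2 : ‖h ∘L Φ.sum t - h ∘L Φ.sum s‖ ≤ δ ^ 2 / (‖h‖ + 1) := by
          have h3 := hM t (hm.trans (hs.trans ht))
          have h4 := hM s (hm.trans hs)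
          have h5 := dist_triangle_right (h ∘L Φ.sum t) (h ∘L Φ.sum s) h
          rw [← dist_eq_norm]
          have h6 : δ ^ 2 / (‖h‖ + 1) = δ ^ 2 / (2 * (‖h‖ + 1)) + δ ^ 2 / (2 * (‖h‖ + 1)) := by
            field_simp; ring
          rw [h6]
          exact h5.trans (add_le_add h3.le h4.le)
        rw [h1, ContinuousLinearMap.norm_smulRight_apply, ContinuousLinearMap.norm_smulRight_apply,
          hy]
        calc ‖h‖ * δ⁻¹ * (‖h ∘L Φ.sum t - h ∘L Φ.sum s‖ * δ⁻¹)
            ≤ ‖h‖ * δ⁻¹ * (δ ^ 2 / (‖h‖ + 1) * δ⁻¹) := by gcongr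
          _ = ‖h‖ / (‖h‖ + 1) := by field_simp
          _ ≤ 1 := by rw [div_le_one (by positivity)]; linarith }
  have h1 := lpInfty_norm_apply_le i z
  rw [apply_eq_op_tail hz] at h1
  change ‖h (Φ.tail m z) • y‖ ≤ ‖z‖ at h1
  rw [norm_smul, hy, ← div_eq_mul_inv, div_le_iff₀ hδ] at h1
  linarith

/-- Off a cutoff almost supporting `u`, `Ψ` has norm at most `2 * ε`; on it, `n + 1` functionals of
tails contribute `ε / (n + 1)` each. -/
theorem exists_norm_apply_sub_partialSum_le (Ψ : StrongDual 𝕜 (Ambient.{u, v, w} Φ))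
    {u : Ambient.{u, v, w} Φ} (hu : u ∈ AssocSpace.{u, v, w} Φ) (hu1 : ‖u‖ ≤ 1) {ε : ℝ}
    (hε : 0 < ε) (hΨu : ‖Ψ‖ - ε < RCLike.re (Ψ u)) :
    ∃ M, ∀ m ≥ M, ∀ z ∈ AssocSpace.{u, v, w} Φ, ‖Ψ (z - Φ.partialSum m z)‖ ≤ 3 * ε * ‖z‖ := by
  obtain ⟨n, hn⟩ := Metric.tendsto_atTop.1 (Φ.tendsto_indicator_cutoff hu) (ε / (‖Ψ‖ + 1))
    (by positivity)
  have hcut : ‖Ψ‖ * ‖u - lpInftyIndicator (𝕜 := 𝕜) (Φ.cutoff n) u‖ ≤ ε := by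
    have := hn n le_rfl
    rw [dist_comm, dist_eq_norm] at this
    calc _ ≤ ‖Ψ‖ * (ε / (‖Ψ‖ + 1)) := by gcongr
      _ ≤ ε := by rw [mul_div_assoc', div_le_iff₀ (by positivity)]; nlinarith
  have hoff := norm_comp_sub_lpInftyIndicator_le Ψ hu1 hΨu hcut
  choose M hM using fun r => exists_norm_apply_tail_le.{u, v, w} Φ (Ψ ∘L Φ.place n r)
    (δ := ε / (n + 1)) (by positivity)
  -- The sum of the thresholds serves as an upper bound for each of them.
  refine ⟨∑ r ∈ Finset.range (n + 1), M r, fun m hm z hz => ?_⟩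
  have hw : z - Φ.partialSum m z ∈ AssocSpace.{u, v, w} Φ :=
    Submodule.sub_mem _ hz (Φ.partialSum_mem m z)
  set y := z - Φ.partialSum m z with hy
  have h1 : ‖Ψ (y - lpInftyIndicator (𝕜 := 𝕜) (Φ.cutoff n) y)‖ ≤ 2 * ε * ‖z‖ := by
    refine (ContinuousLinearMap.le_of_opNorm_le _ hoff y).trans ?_
    gcongr
    exact norm_sub_partialSum_le m hz
  have h2 : ‖Ψ (lpInftyIndicator (𝕜 := 𝕜) (Φ.cutoff n) y)‖ ≤ ε * ‖z‖ := by
    rw [Φ.indicator_cutoff_eq_sum n hw, map_sum]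
    calc _ ≤ ∑ r ∈ Finset.range (n + 1), ε / (n + 1) * ‖z‖ := by
          refine norm_sum_le_of_le _ fun r hr => ?_
          rw [hy, tail_sub_partialSum r m hz]
          refine hM r _ (le_trans ?_ (le_max_right _ _)) z hz
          exact (Finset.single_le_sum (f := M) (fun _ _ => Nat.zero_le _) hr).trans hm
      _ = ε * ‖z‖ := by
          rw [Finset.sum_const, Finset.card_range, nsmul_eq_mul]
          push_cast
          field_simp
  have h3 : Ψ y = Ψ (y - lpInftyIndicator (𝕜 := 𝕜) (Φ.cutoff n) y) +
      Ψ (lpInftyIndicator (𝕜 := 𝕜) (Φ.cutoff n) y) := by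
    rw [← map_add, sub_add_cancel]
  rw [h3]
  refine (norm_add_le _ _).trans ((add_le_add h1 h2).trans_eq ?_)
  ring

/-- A norm-preserving extension of `φ` to the ambient space almost attains its norm at a vector of
the associated space, because `φ` does. -/
theorem isShrinking_basis : (basis.{u, v, w} Φ).IsShrinking := by
  refine SchauderBasis.isShrinking_of_norm_apply_sub_le _ fun φ ε hε => ?_
  obtain ⟨Ψ, hΨ, hΨφ⟩ := exists_extension_norm_eq _ φ
  obtain ⟨u, hu, hφu⟩ := φ.exists_norm_le_one_lt_re (show 0 < ε / 3 by positivity)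
  obtain ⟨M, hM⟩ := Φ.exists_norm_apply_sub_partialSum_le Ψ u.2 hu (ε := ε / 3) (by positivity)
    (by rw [hΨ, hΨφ]; exact hφu)
  refine ⟨M, fun m hm z => ?_⟩
  have h1 := hM m hm z z.2
  rw [← basis_proj_apply, ← Submodule.coe_sub, hΨ, mul_div_cancel₀ ε three_ne_zero] at h1
  exact h1

end ShrinkingFrame

/-! ### From a shrinking basis to bounded approximation -/

section BAP

/-- The operators `p ∘L d.proj n ∘L i` are uniformly bounded and converge pointwise to the identity,
hence uniformly on compact sets. -/
theorem HasBAP.of_schauderBasis {𝕜 : Type*} [RCLike 𝕜] {E F : Type*} [NormedAddCommGroup E]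
    [NormedSpace 𝕜 E] [NormedAddCommGroup F] [NormedSpace 𝕜 F] [CompleteSpace F]
    (d : SchauderBasis 𝕜 F) (i : E →L[𝕜] F) (p : F →L[𝕜] E) (hpi : ∀ x, p (i x) = x) :
    HasBAP 𝕜 E := by
  obtain ⟨C, hC⟩ := d.exists_norm_proj_le
  have hC0 : 0 ≤ C := (norm_nonneg _).trans (hC 0)
  refine ⟨‖p‖ * (C * ‖i‖), fun K hK ε hε => ?_⟩
  have hT : ∀ n, ‖p ∘L d.proj n ∘L i‖ ≤ ‖p‖ * (C * ‖i‖) := fun n =>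
    (ContinuousLinearMap.opNorm_comp_le _ _).trans (mul_le_mul_of_nonneg_left
      ((ContinuousLinearMap.opNorm_comp_le _ _).trans (by gcongr; exact hC n)) (norm_nonneg _))
  have hlim : ∀ x, Filter.Tendsto (fun n => (p ∘L d.proj n ∘L i) x) Filter.atTop (nhds x) := by
    intro x
    have := (p.continuous.tendsto _).comp (d.tendsto_proj (i x))
    rwa [hpi] at this
  set T := fun n => p ∘L d.proj n ∘L i with hTdef
  set L := ‖p‖ * (C * ‖i‖) with hL
  have hL0 : 0 ≤ L := by positivity
  obtain ⟨t, -, htf, ht⟩ := Metric.finite_approx_of_totallyBounded hK.totallyBounded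
    (ε / (L + 2)) (by positivity)
  have hev : ∀ᶠ n in Filter.atTop, ∀ y ∈ t, dist (T n y) y < ε / (L + 2) :=
    (htf.eventually_all).2 fun y _ => Metric.tendsto_nhds.1 (hlim y) _ (by positivity)
  obtain ⟨n, hn⟩ := hev.exists
  refine ⟨T n, ?_, hT n, fun x hx => ?_⟩
  · have : FiniteDimensional 𝕜 (LinearMap.range (d.proj n).toLinearMap) := by
      rw [d.range_proj_eq_span]
      exact FiniteDimensional.span_of_finite 𝕜 ((Finset.finite_toSet _).image _)
    exact ContinuousLinearMap.IsFiniteRank.of_range_le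
      (F := (LinearMap.range (d.proj n).toLinearMap).map p.toLinearMap)
      fun x => ⟨d.proj n (i x), ⟨i x, rfl⟩, rfl⟩
  · obtain ⟨y, hy, hxy⟩ := Set.mem_iUnion₂.1 (ht hx)
    rw [Metric.mem_ball, dist_eq_norm] at hxy
    have h1 := hn y hy
    rw [dist_eq_norm] at h1
    have h2 : ‖T n (x - y)‖ ≤ L * (ε / (L + 2)) :=
      ((T n).le_of_opNorm_le (hT n) _).trans (by gcongr)
    have h3 : x - T n x = (x - y) - T n (x - y) - (T n y - y) := by
      rw [map_sub]; abel
    rw [h3]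
    refine (norm_sub_le _ _).trans ((add_le_add (norm_sub_le _ _) le_rfl).trans ?_)
    have h4 : ε / (L + 2) + L * (ε / (L + 2)) + ε / (L + 2) = ε := by field_simp; ring
    linarith

theorem HasBAP.dual_of_embedsComplementably {𝕜 : Type*} [RCLike 𝕜] {E F : Type*}
    [NormedAddCommGroup E] [NormedSpace 𝕜 E] [NormedAddCommGroup F] [NormedSpace 𝕜 F]
    {b : SchauderBasis 𝕜 F} (hb : b.IsShrinking) (h : EmbedsComplementably 𝕜 E F) :
    HasBAP 𝕜 (StrongDual 𝕜 E) := by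
  obtain ⟨d, -⟩ := hb
  obtain ⟨Y, ⟨q, hq⟩, ⟨e⟩⟩ := h
  let i : E →L[𝕜] F := Y.subtypeL ∘L e.toContinuousLinearMap
  let p : F →L[𝕜] E := e.symm.toContinuousLinearMap ∘L q
  have hpi : ∀ x, p (i x) = x := fun x => by simp [p, i, hq]
  -- Adjoints exchange the roles: that of `p` embeds the dual of `E`, and that of `i` is its left
  -- inverse.
  refine HasBAP.of_schauderBasis d ((ContinuousLinearMap.compL 𝕜 F E 𝕜).flip p)
    ((ContinuousLinearMap.compL 𝕜 E F 𝕜).flip i) fun g => ?_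
  ext x
  simp [hpi]

end BAP

theorem nonempty_shrinkingFrame_self (𝕜 : Type*) [RCLike 𝕜] : Nonempty (ShrinkingFrame 𝕜 𝕜) :=
  nonempty_shrinkingFrame_of_approximating_seq (fun _ => ContinuousLinearMap.id 𝕜 𝕜)
    (fun _ => .of_range_le (F := ⊤) fun _ => Submodule.mem_top)
    (fun _ => tendsto_const_nhds) fun _ => tendsto_const_nhds

theorem embedsComplementably_of_subsingleton {𝕜 : Type*} [RCLike 𝕜] {E F : Type*}
    [NormedAddCommGroup E] [NormedSpace 𝕜 E] [NormedAddCommGroup F] [NormedSpace 𝕜 F]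
    [Subsingleton E] : EmbedsComplementably 𝕜 E F :=
  ⟨⊥, Submodule.closedComplemented_bot, ⟨ContinuousLinearEquiv.equivOfInverse 0 0
    (fun _ => Subsingleton.elim _ _) fun _ => Subsingleton.elim _ _⟩⟩

theorem theorem5p2 (𝕜 : Type u) [RCLike 𝕜] (X : Type v) [NormedAddCommGroup X] [NormedSpace 𝕜 X]
    [CompleteSpace X] [TopologicalSpace.SeparableSpace (StrongDual 𝕜 X)] :
    HasBAP 𝕜 (StrongDual 𝕜 X) ↔
      ∃ (Z : Type (max u v w)) (_ : NormedAddCommGroup Z) (_ : NormedSpace 𝕜 Z)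
        (_ : CompleteSpace Z),
        (∃ b : SchauderBasis 𝕜 Z, b.IsShrinking) ∧ EmbedsComplementably 𝕜 X Z := by
  constructor
  · intro h
    rcases subsingleton_or_nontrivial X with hX | hX
    -- The zero space carries no frame with nonzero vectors; any space with a shrinking basis
    -- serves.
    · obtain ⟨Φ⟩ := nonempty_shrinkingFrame_self 𝕜
      exact ⟨ShrinkingFrame.AssocSpace.{u, u, max v w} Φ, inferInstance, inferInstance,
        inferInstance, ⟨_, Φ.isShrinking_basis⟩, embedsComplementably_of_subsingleton⟩
    · obtain ⟨T, hT, hTx, hTg⟩ := h.exists_approximating_seq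
      obtain ⟨Φ⟩ := nonempty_shrinkingFrame_of_approximating_seq T hT hTx hTg
      exact ⟨ShrinkingFrame.AssocSpace.{u, v, w} Φ, inferInstance, inferInstance, inferInstance,
        ⟨_, Φ.isShrinking_basis⟩, Φ.embedsComplementably⟩
  · rintro ⟨Z, _, _, _, ⟨b, hb⟩, hXZ⟩
    exact HasBAP.dual_of_embedsComplementably hb hXZ
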